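/- **Conventions.** A $\mathbb{C}[[\hbar]]$-module is *topologically free* if it is isomorphic to $W_0[[\hbar]]$ for a complex vector space $W_0$ (equivalently: Hausdorff, complete for the $\hbar$-adic topology, and $\hbar$-torsion free); for such modules $W_0[[\hbar]]\,\widehat\otimes\,W_0'[[\hbar]]=(W_0\otimes W_0')[[\hbar]]$. For topologically free $W=W_0[[\hbar]]$ put $\mathcal E_\hbar(W)=\mathrm{Hom}_{\mathbb{C}[[\hbar]]}(W,W_0((z))[[\hbar]])$. A subset of $\mathcal E_\hbar(W)$ is *$\hbar$-adically compatible* if for every finite sequence $a_1(z),\dots,a_r(z)$ in it and every $n\ge 1$ there is $m$ such that $\prod_{i<j}(z_i-z_j)^m a_1(z_1)\cdots a_r(z_r)$ maps $W$ into $(W/\hbar^nW)((z_1,\dots,z_r))$ modulo $\hbar^n$. For a compatible pair, $Y_{\mathcal E}(a(z),z_0)b(z)$ is the series which modulo each $\hbar^n$ equals $z_0^{-k}\big((z_1-z)^{k}a(z_1)b(z)\big)|_{z_1=z+z_0}$, for any $k$ with $(z_1-z)^{k}a(z_1)b(z)$ mapping $W$ into $(W/\hbar^nW)((z_1,z))$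 modulo $\hbar^n$. An *$\hbar$-adic nonlocal vertex algebra* is a topologically free $\mathbb{C}[[\hbar]]$-module $V$ with a vector $\mathbb 1\in V$ and a $\mathbb{C}[[\hbar]]$-linear map $Y(\cdot,z):V\to\mathcal E_\hbar(V)$, $Y(u,z)=\sum_{m\in\mathbb Z}u_mz^{-m-1}$, such that $Y(\mathbb 1,z)v=v$, $Y(v,z)\mathbb 1\in V[[z]]$, $\lim_{z\to0}Y(v,z)\mathbb 1=v$, the set $\{Y(u,z)\mid u\in V\}$ is $\hbar$-adically compatible, and $Y_{\mathcal E}(Y(u,z),z_0)Y(v,z)=Y(Y(u,z_0)v,z)$ for all $u,v\in V$. A *$V$-module* is a topologically free $\mathbb{C}[[\hbar]]$-module $W$ with a $\mathbb{C}[[\hbar]]$-linear map $Y_W(\cdot,z):V\to\mathcal E_\hbar(W)$ such that $Y_W(\mathbb 1,z)=1_W$, $\{Y_W(u,z)\mid u\in V\}$ is $\hbar$-adically compatible, and $Y_{\mathcal E}(Y_W(u,z),z_0)Y_W(v,z)=Y_W(Y(u,z_0)v,z)$ for all $u,v\in V$. An *$\hbar$-adic quantum vertex algebra* is an $\hbar$-adic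 nonlocal vertex algebra $V$ with a $\mathbb{C}[[\hbar]]$-linear map $S(z):V\widehat\otimes V\to V\widehat\otimes V\widehat\otimes\mathbb{C}((z))[[\hbar]]$ (the quantum Yang–Baxter operator) satisfying, with $\partial u=\lim_{z\to0}\frac{d}{dz}Y(u,z)\mathbb 1$, with $Y(z)(u\otimes v)=Y(u,z)v$, and with functions of a sum or difference of two variables expanded in nonnegative powers of the second variable: $[\partial\otimes1,S(z)]=-\frac{d}{dz}S(z)$; $S^{12}(z_1)S^{13}(z_1+z_2)S^{23}(z_2)=S^{23}(z_2)S^{13}(z_1+z_2)S^{12}(z_1)$; $S^{21}(z)S(-z)=1$; $S(z)(\mathbb 1\otimes v)=\mathbb 1\otimes v$; $S(z_1)Y^{12}(z_2)=Y^{12}(z_2)S^{23}(z_1)S^{13}(z_1+z_2)$; and $S$-locality: for all $u,v\in V$ and $n\ge1$ there is $k\ge0$ with $$(z_1-z_2)^kY(u,z_1)Y(v,z_2)\equiv(z_1-z_2)^kY(z_2)(1\otimes Y(z_1))S(z_2-z_1)(v\otimes u)\pmod{\hbar^n}.$$ For a submodule $N\subseteq V$ let $\overline N$ be its $\hbar$-adic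 closure, $[N]=\{v\in V\mid\hbar^nv\in N\text{ for some }n\ge1\}$ and $N'=\mathrm{span}_{\mathbb{C}[[\hbar]]}\{u_mv\mid u,v\in N,\ m\in\mathbb Z\}$. For a subset $U\subseteq V$ put $U^{(1)}=\overline{[\mathrm{span}_{\mathbb{C}[[\hbar]]}(U\cup\{\mathbb 1\})]}$ and $U^{(n+1)}=\overline{[(U^{(n)})']}$. One says that $V$ is *generated by* $U$ if $\overline{[\bigcup_{n\ge1}U^{(n)}]}=V$. Moreover $U\widehat\otimes U$ and $U\widehat\otimes U\widehat\otimes\mathbb{C}((z))[[\hbar]]$ denote the closed $\mathbb{C}[[\hbar]]$-spans of the elements $u\otimes v$, respectively $u\otimes v\otimes f$, with $u,v\in U$ and $f\in\mathbb{C}((z))[[\hbar]]$. **Proposition.** Let $V$ be an $\hbar$-adic quantum vertex algebra with quantum Yang–Baxter operator $S(z)$ and let $(W,Y_W)$ be a $V$-module. Let $U$ be a subset of $V$ such that $V$ is generated by $U$ and $$S(z)(U\widehat\otimes U)\subseteq U\widehat\otimes U\widehat\otimes\mathbb{C}((z))[[\hbar]].$$ Suppose that $w^+\in W$ satisfies $Y_W(u,z)w^+\in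 W[[z]]$ for all $u\in U$. Then $Y_W(u,z)w^+\in W[[z]]$ for all $u\in V$. -/

import Mathlib

open scoped TensorProduct

noncomputable section

namespace HAdic

/-! ### Modules over `ℂ[[ħ]]` and the `ħ`-adic topology -/

/-- The ring `ℂ[[ħ]]`; its formal variable is `ħ`. -/
def Ch : Type := PowerSeries ℂ

instance : CommRing Ch := inferInstanceAs (CommRing (PowerSeries ℂ))



/-- The formal variable `ħ`. -/
def hbar : Ch := (PowerSeries.X : PowerSeries ℂ)

/-- The ideal `(ħ)` of `ℂ[[ħ]]`. -/
abbrev hI : Ideal Ch := Ideal.span {hbar}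

/-- The submodule `ħ^n M`. -/
abbrev hpow (n : ℕ) (M : Type*) [AddCommGroup M] [Module Ch M] : Submodule Ch M :=
  hI ^ n • (⊤ : Submodule Ch M)

/-- The reduction `M / ħ^n M`. -/
def Red (n : ℕ) (M : Type*) [AddCommGroup M] [Module Ch M] : Type _ := M ⧸ hpow n M

instance (n : ℕ) (M : Type*) [AddCommGroup M] [Module Ch M] : AddCommGroup (Red n M) :=
  inferInstanceAs (AddCommGroup (M ⧸ hpow n M))

instance (n : ℕ) (M : Type*) [AddCommGroup M] [Module Ch M] : Module Ch (Red n M) :=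
  inferInstanceAs (Module Ch (M ⧸ hpow n M))

/-- The quotient map `M → M / ħ^n M`. -/
def red (n : ℕ) (M : Type*) [AddCommGroup M] [Module Ch M] : M →ₗ[Ch] Red n M :=
  (hpow n M).mkQ

theorem red_surjective (n : ℕ) (M : Type*) [AddCommGroup M] [Module Ch M] :
    Function.Surjective (red n M) :=
  Submodule.mkQ_surjective _

theorem red_eq_zero_iff {n : ℕ} {M : Type*} [AddCommGroup M] [Module Ch M] {x : M} :
    red n M x = 0 ↔ x ∈ hpow n M :=
  Submodule.Quotient.mk_eq_zero _

/-- Topologically free `ℂ[[ħ]]`-modules, i.e. modules isomorphic to `M₀[[ħ]]` for a complex vector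
space `M₀`: the modules that are Hausdorff and complete for the `ħ`-adic topology and have no
`ħ`-torsion. -/
class TopFree (M : Type*) [AddCommGroup M] [Module Ch M] : Prop where
  complete : IsAdicComplete hI M
  torsionFree : ∀ x : M, hbar • x = 0 → x = 0

/-- The closure of a submodule in the `ħ`-adic topology. -/
def hClosure {M : Type*} [AddCommGroup M] [Module Ch M] (N : Submodule Ch M) :
    Submodule Ch M where
  carrier := {x | ∀ n : ℕ, ∃ y ∈ N, x - y ∈ hpow n M}
  zero_mem' := fun n => ⟨0, N.zero_mem, by simp⟩
  add_mem' := by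
    intro x x' hx hx' n
    obtain ⟨y, hy, h⟩ := hx n
    obtain ⟨y', hy', h'⟩ := hx' n
    exact ⟨y + y', N.add_mem hy hy', by
      rw [add_sub_add_comm]; exact (hpow n M).add_mem h h'⟩
  smul_mem' := by
    intro c x hx n
    obtain ⟨y, hy, h⟩ := hx n
    exact ⟨c • y, N.smul_mem c hy, by
      rw [← smul_sub]; exact (hpow n M).smul_mem c h⟩

/-- The submodule `[N] = {x | ħ^n x ∈ N for some n ≥ 1}`. -/
def saturation {M : Type*} [AddCommGroup M] [Module Ch M] (N : Submodule Ch M) :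
    Submodule Ch M where
  carrier := {x | ∃ n : ℕ, 1 ≤ n ∧ hbar ^ n • x ∈ N}
  zero_mem' := ⟨1, le_rfl, by simp⟩
  add_mem' := by
    rintro x y ⟨m, hm, hx⟩ ⟨n, _, hy⟩
    refine ⟨m + n, by omega, ?_⟩
    rw [smul_add]
    refine N.add_mem ?_ ?_
    · rw [add_comm, pow_add, mul_smul]; exact N.smul_mem _ hx
    · rw [pow_add, mul_smul]; exact N.smul_mem _ hy
  smul_mem' := by
    rintro c x ⟨n, hn, hx⟩
    exact ⟨n, hn, by rw [smul_comm]; exact N.smul_mem c hx⟩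

/-! ### Formal series -/

/-- Multiplication of a formal series `A ∈ M[[z_i^{±1} : i ∈ σ]]`, given by its coefficients, by a
polynomial in the variables `z_i`. -/
def polyMul {σ M : Type*} [AddCommGroup M] (p : MvPolynomial σ ℤ) (A : (σ → ℤ) → M) :
    (σ → ℤ) → M :=
  fun e => ∑ d ∈ p.support, p.coeff d • A fun i => e i - (d i : ℤ)

/-- The polynomial `∏_{i < j} (z_i - z_j)^m` in `r` variables. -/
def diffProd (r m : ℕ) : MvPolynomial (Fin r) ℤ :=
  ∏ i : Fin r, ∏ j ∈ Finset.Ioi i, (MvPolynomial.X i - MvPolynomial.X j) ^ m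

section Fields

variable {W : Type*} [AddCommGroup W] [Module Ch W]

/-- Elements of `Hom(W, W[[z, z⁻¹]])`: for `a : PreField W`, the coefficient of `z^k` in `a(z)w` is
`a w k`. -/
abbrev PreField (W : Type*) [AddCommGroup W] [Module Ch W] : Type _ := W →ₗ[Ch] (ℤ → W)

/-- `a(z)` lies in `ℰ_ħ(W) = Hom(W, W₀((z))[[ħ]])`, where `W = W₀[[ħ]]`: for every `n` and `w`, the
series `a(z)w` modulo `ħ^n` has only finitely many negative powers of `z`. -/
def IsHField (a : PreField W) : Prop :=
  ∀ (n : ℕ) (w : W), ∃ N : ℤ, ∀ k < N, a w k ∈ hpow n W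

/-- The coefficients of `a_0(z_0) a_1(z_1) ⋯ a_{r-1}(z_{r-1}) w`. -/
def iter : {r : ℕ} → (Fin r → PreField W) → W → (Fin r → ℤ) → W
  | 0, _, w, _ => w
  | _ + 1, a, w, e => a 0 (iter (Fin.tail a) w (Fin.tail e)) (e 0)

/-- Modulo `ħ^n`, the product of `∏_{i<j} (z_i - z_j)^m` and `a_0(z_0) ⋯ a_{r-1}(z_{r-1})` maps
`W` to `(W/ħ^n W)((z_0, …, z_{r-1}))`. -/
def CompatibleAt (n m : ℕ) {r : ℕ} (a : Fin r → PreField W) : Prop :=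
  ∀ w : W, ∃ N : ℤ, ∀ e : Fin r → ℤ, (∃ i, e i < N) →
    polyMul (diffProd r m) (fun e' => red n W (iter a w e')) e = 0

/-- A set of fields is `ħ`-adically compatible if every finite sequence in it is compatible modulo
every power of `ħ`. -/
def HCompatible (T : Set (PreField W)) : Prop :=
  ∀ (r : ℕ) (a : Fin r → PreField W), (∀ i, a i ∈ T) → ∀ n : ℕ, ∃ m : ℕ, CompatibleAt n m a

/-- The coefficient of `z_0^i z^c`, modulo `ħ^n`, of `Y_ℰ(a(z), z_0) b(z) w`, i.e. of
`z_0^{-k} ((z_1 - z)^k a(z_1) b(z) w)|_{z_1 = z + z_0}`, where `(z + z_0)^p` is expanded in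
nonnegative powers of `z_0`. It is meaningful if `CompatibleAt n k ![a, b]`; then the sum
is finite. -/
def YE (n k : ℕ) (a b : PreField W) (w : W) (i c : ℤ) : Red n W :=
  if 0 ≤ i + k then
    ∑ᶠ p : ℤ, Ring.choose p (i + k).toNat •
      polyMul (diffProd 2 k) (fun e => red n W (iter ![a, b] w e)) ![p, c + (i + k) - p]
  else 0

end Fields

/-! ### `ħ`-adic nonlocal vertex algebras and their modules -/

/-- An `ħ`-adic nonlocal vertex algebra structure on a topologically free `ℂ[[ħ]]`-module `V`. The
coefficient of `z^k` in `Y(u, z)v` is `Y u v k`; thus `u_m v = Y u v (-m - 1)`. -/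
structure NonlocalVA (V : Type*) [AddCommGroup V] [Module Ch V] [TopFree V] where
  vac : V
  Y : V →ₗ[Ch] PreField V
  field : ∀ u, IsHField (Y u)
  vac_left : ∀ v, Y vac v = Pi.single 0 v
  vac_right : ∀ v, ∀ k < 0, Y v vac k = 0
  creation : ∀ v, Y v vac 0 = v
  compatible : HCompatible (Set.range Y)
  assoc : ∀ (u v : V) (n k : ℕ), CompatibleAt n k ![Y u, Y v] →
    ∀ (w : V) (i c : ℤ), YE n k (Y u) (Y v) w i c = red n V (Y (Y u v i) w c)

/-- A module `(W, Y_W)` for an `ħ`-adic nonlocal vertex algebra, on the topologically free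
`ℂ[[ħ]]`-module `W`. -/
structure VAModule {V : Type*} [AddCommGroup V] [Module Ch V] [TopFree V] (A : NonlocalVA V)
    (W : Type*) [AddCommGroup W] [Module Ch W] [TopFree W] where
  Y : V →ₗ[Ch] PreField W
  field : ∀ u, IsHField (Y u)
  vac_left : ∀ w, Y A.vac w = Pi.single 0 w
  compatible : HCompatible (Set.range Y)
  assoc : ∀ (u v : V) (n k : ℕ), CompatibleAt n k ![Y u, Y v] →
    ∀ (w : W) (i c : ℤ), YE n k (Y u) (Y v) w i c = red n W (Y (A.Y u v i) w c)

namespace NonlocalVA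

variable {V : Type*} [AddCommGroup V] [Module Ch V] [TopFree V] (A : NonlocalVA V)

/-- The canonical derivation `∂u = lim_{z → 0} d/dz Y(u, z)𝟙`. -/
def der : V →ₗ[Ch] V :=
  LinearMap.proj (1 : ℤ) ∘ₗ A.Y.flip A.vac

/-- The coefficient of `z^k` in `Y(z) : V ⊗ V → V[[z, z⁻¹]]`, `Y(z)(u ⊗ v) = Y(u, z)v`. -/
def Ycoeff (k : ℤ) : V ⊗[Ch] V →ₗ[Ch] V :=
  LinearMap.proj k ∘ₗ TensorProduct.lift A.Y

/-- `U' = span {u_m v | u, v ∈ U, m ∈ ℤ}`. -/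
def prime (U : Submodule Ch V) : Submodule Ch V :=
  Submodule.span Ch {x | ∃ u ∈ U, ∃ v ∈ U, ∃ m : ℤ, x = A.Y u v (-m - 1)}

/-- `genStep S n` is `S^{(n+1)}`, where `S^{(1)}` is the closure of `[span (S ∪ {𝟙})]` and
`S^{(n+1)}` is the closure of `[(S^{(n)})']`. -/
def genStep (S : Set V) : ℕ → Submodule Ch V
  | 0 => hClosure (saturation (Submodule.span Ch (S ∪ {A.vac})))
  | n + 1 => hClosure (saturation (A.prime (genStep S n)))

/-- `⟨S⟩`, the closure of `[⋃ S^{(n)}]` (the `S^{(n)}` form an increasing chain). -/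
def generated (S : Set V) : Submodule Ch V :=
  hClosure (saturation (⨆ n, A.genStep S n))

/-- `V` is generated by the subset `S`. -/
def IsGeneratedBy (S : Set V) : Prop := A.generated S = ⊤

end NonlocalVA

/-! ### Laurent series -/

/-- The field `ℂ((z))`. -/
def Lau : Type := LaurentSeries ℂ

instance : CommRing Lau := inferInstanceAs (CommRing (LaurentSeries ℂ))

instance : Algebra ℂ Lau := (HahnSeries.instAlgebra : Algebra ℂ (LaurentSeries ℂ))

/-- The field `ℂ((x))((y))`; the inner variable is `x`, the outer one is `y`. -/
def Lau2 : Type := LaurentSeries Lau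

instance : CommRing Lau2 := inferInstanceAs (CommRing (LaurentSeries Lau))

instance : Algebra ℂ Lau2 := (HahnSeries.instAlgebra : Algebra ℂ (HahnSeries ℤ Lau))

/-- The coefficient of `z^p`. -/
def Lau.coeff (p : ℤ) : Lau →ₗ[ℂ] ℂ where
  toFun f := HahnSeries.coeff (f : LaurentSeries ℂ) p
  map_add' _ _ := rfl
  map_smul' _ _ := rfl

/-- The coefficient of `y^q`, an element of `ℂ((x))`. -/
def Lau2.coeff (q : ℤ) : Lau2 →ₗ[ℂ] Lau where
  toFun f := HahnSeries.coeff (f : LaurentSeries Lau) q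
  map_add' _ _ := rfl
  map_smul' _ _ := rfl

@[ext]
theorem Lau.ext {f g : Lau} (h : ∀ p, Lau.coeff p f = Lau.coeff p g) : f = g :=
  HahnSeries.ext (funext h)

@[ext]
theorem Lau2.ext {f g : Lau2} (h : ∀ q, Lau2.coeff q f = Lau2.coeff q g) : f = g :=
  HahnSeries.ext (funext h)

/-- The divided derivative `(1/q!) (d/dz)^q` on `ℂ((z))`. -/
def Lau.hasseDeriv (q : ℕ) : Lau →ₗ[ℂ] Lau where
  toFun f := LaurentSeries.hasseDeriv ℂ q (f : LaurentSeries ℂ)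
  map_add' f g := map_add (LaurentSeries.hasseDeriv ℂ q) (f : LaurentSeries ℂ) g
  map_smul' c f := map_smul (LaurentSeries.hasseDeriv ℂ q) c (f : LaurentSeries ℂ)

/-- `f(z) ↦ f(x)`. -/
def atInner : Lau →ₗ[ℂ] Lau2 where
  toFun f := (HahnSeries.C f : LaurentSeries Lau)
  map_add' f g := map_add (HahnSeries.C : Lau →+* LaurentSeries Lau) f g
  map_smul' c f := by
    ext q : 1
    change (HahnSeries.C (c • f) : LaurentSeries Lau).coeff q
      = c • (HahnSeries.C f : LaurentSeries Lau).coeff q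
    by_cases hq : q = 0 <;> simp [HahnSeries.C_apply, hq]

/-- `f(z) ↦ f(y)`. -/
def atOuter : Lau →ₗ[ℂ] Lau2 where
  toFun f := (HahnSeries.map (f : LaurentSeries ℂ) (algebraMap ℂ Lau) : LaurentSeries Lau)
  map_add' f g := by
    ext q : 1
    exact map_add (algebraMap ℂ Lau) (Lau.coeff q f) (Lau.coeff q g)
  map_smul' c f := by
    ext q : 1
    change algebraMap ℂ Lau (c • Lau.coeff q f) = c • algebraMap ℂ Lau (Lau.coeff q f)
    rw [smul_eq_mul, map_mul, Algebra.smul_def]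

/-- `f(z) ↦ f(x + εy)`, expanded in nonnegative powers of `y`, i.e. the series
`∑_{q ≥ 0} (1/q!) f^{(q)}(x) (εy)^q`. -/
def taylor (ε : ℂ) : Lau →ₗ[ℂ] Lau2 where
  toFun f := HahnSeries.ofSuppBddBelow
    (fun q : ℤ => if 0 ≤ q then ε ^ q.toNat • Lau.hasseDeriv q.toNat f else 0)
    ⟨0, fun q hq => by by_contra h; exact hq (if_neg h)⟩
  map_add' f g := by
    ext q : 1
    change (if 0 ≤ q then ε ^ q.toNat • Lau.hasseDeriv q.toNat (f + g) else 0)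
      = (if 0 ≤ q then ε ^ q.toNat • Lau.hasseDeriv q.toNat f else 0)
        + (if 0 ≤ q then ε ^ q.toNat • Lau.hasseDeriv q.toNat g else 0)
    split_ifs <;> simp
  map_smul' c f := by
    ext q : 1
    change (if 0 ≤ q then ε ^ q.toNat • Lau.hasseDeriv q.toNat (c • f) else 0)
      = c • (if 0 ≤ q then ε ^ q.toNat • Lau.hasseDeriv q.toNat f else 0)
    split_ifs
    · rw [map_smul, smul_comm]
    · rw [smul_zero]

/-- `f(z) ↦ f(-z)`. -/
def atNeg : Lau →ₗ[ℂ] Lau where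
  toFun f := (HahnSeries.mk (fun p => (Int.negOnePow p : ℤ) • Lau.coeff p f)
    ((HahnSeries.isPWO_support (f : LaurentSeries ℂ)).mono fun p hp h => hp
      ((congrArg ((Int.negOnePow p : ℤ) • ·) h).trans (smul_zero _))) : LaurentSeries ℂ)
  map_add' f g := by
    ext p
    change (Int.negOnePow p : ℤ) • Lau.coeff p (f + g)
      = (Int.negOnePow p : ℤ) • Lau.coeff p f + (Int.negOnePow p : ℤ) • Lau.coeff p g
    rw [map_add, smul_add]
  map_smul' c f := by
    ext p
    change (Int.negOnePow p : ℤ) • Lau.coeff p (c • f)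
      = c • ((Int.negOnePow p : ℤ) • Lau.coeff p f)
    rw [map_smul, smul_comm]

/-! ### The algebras `R[[ħ]]` -/

/-- The ring `R[[ħ]]`, for a commutative `ℂ`-algebra `R`. -/
def PSH (R : Type) [CommRing R] : Type := PowerSeries R

section PSH

variable {R R' : Type} [CommRing R] [CommRing R']

instance : CommRing (PSH R) := inferInstanceAs (CommRing (PowerSeries R))

/-- The coefficient of `ħ^n`. -/
def PSH.coeff (n : ℕ) : PSH R →+ R :=
  (PowerSeries.coeff n : PowerSeries R →ₗ[R] R).toAddMonoidHom

/-- The series with given coefficients. -/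
def PSH.mk (a : ℕ → R) : PSH R := (PowerSeries.mk a : PowerSeries R)

@[simp]
theorem PSH.coeff_mk (n : ℕ) (a : ℕ → R) : PSH.coeff n (PSH.mk a) = a n :=
  PowerSeries.coeff_mk n a

@[ext]
theorem PSH.ext {f g : PSH R} (h : ∀ n, PSH.coeff n f = PSH.coeff n g) : f = g :=
  PowerSeries.ext h

variable [Algebra ℂ R] [Algebra ℂ R']

/-- `ℂ[[ħ]]` acts on `R[[ħ]]` by multiplication. -/
instance : Algebra Ch (PSH R) :=
  (PowerSeries.map (algebraMap ℂ R) : PowerSeries ℂ →+* PowerSeries R).toAlgebra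

theorem PSH.coeff_smul (n : ℕ) (c : Ch) (f : PSH R) :
    PSH.coeff n (c • f) = ∑ ij ∈ Finset.HasAntidiagonal.antidiagonal n,
      PowerSeries.coeff ij.1 (c : PowerSeries ℂ) • PSH.coeff ij.2 f := by
  refine (PowerSeries.coeff_mul n (PowerSeries.map (algebraMap ℂ R) (c : PowerSeries ℂ))
    (show PowerSeries R from f)).trans (Finset.sum_congr rfl fun ij _ => ?_)
  exact (congrArg (· * PSH.coeff ij.2 f) (PowerSeries.coeff_map (algebraMap ℂ R) ij.1
    (show PowerSeries ℂ from c))).trans (Algebra.smul_def _ _).symm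

/-- The `ℂ[[ħ]]`-linear map `R[[ħ]] → R'[[ħ]]` given by applying a `ℂ`-linear map to the
coefficients. -/
def PSH.map (φ : R →ₗ[ℂ] R') : PSH R →ₗ[Ch] PSH R' where
  toFun f := PSH.mk fun n => φ (PSH.coeff n f)
  map_add' f g := PSH.ext fun n => by simp only [map_add, PSH.coeff_mk]
  map_smul' c f := PSH.ext fun n => by
    simp only [RingHom.id_apply, PSH.coeff_smul, PSH.coeff_mk, map_sum, map_smul]

/-- The ring `R[[ħ]]` for `R = ℂ` is `ℂ[[ħ]]`. -/
def PSH.toCh : PSH ℂ →ₗ[Ch] Ch where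
  toFun f := (f : PowerSeries ℂ)
  map_add' _ _ := rfl
  map_smul' c f := PowerSeries.ext fun n =>
    (PSH.coeff_smul n c f).trans (PowerSeries.coeff_mul n (show PowerSeries ℂ from c)
      (show PowerSeries ℂ from f)).symm

end PSH

/-- `ℂ((z))[[ħ]]`. -/
abbrev LauH : Type := PSH Lau

/-- `ℂ((x))((y))[[ħ]]`. -/
abbrev Lau2H : Type := PSH Lau2

/-! ### Completed tensor products and their reductions -/

section Reductions

variable {M N P : Type*} [AddCommGroup M] [Module Ch M] [AddCommGroup N] [Module Ch N]
  [AddCommGroup P] [Module Ch P]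

/-- A linear map to a module that is killed by `ħ^n` vanishes on multiples of `ħ^n`. -/
theorem hpow_le_ker {n : ℕ} (f : M →ₗ[Ch] P) (hP : ∀ x : P, hbar ^ n • x = 0) :
    hpow n M ≤ LinearMap.ker f := by
  intro x hx
  rw [hpow, Ideal.span_singleton_pow, Submodule.ideal_span_singleton_smul] at hx
  obtain ⟨y, -, rfl⟩ := (Submodule.mem_smul_pointwise_iff_exists _ _ _).1 hx
  rw [LinearMap.mem_ker, map_smul, hP]

theorem smul_red {n : ℕ} (x : Red n M) : hbar ^ n • x = 0 := by
  obtain ⟨y, rfl⟩ := red_surjective n M x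
  rw [← map_smul, red_eq_zero_iff]
  exact Submodule.smul_mem_smul (Ideal.pow_mem_pow (Ideal.mem_span_singleton_self _) n) trivial

theorem smul_tensor {n : ℕ} (hM : ∀ x : M, hbar ^ n • x = 0) (t : M ⊗[Ch] N) :
    hbar ^ n • t = 0 := by
  induction t with
  | zero => simp
  | tmul x y => rw [TensorProduct.smul_tmul', hM, TensorProduct.zero_tmul]
  | add x y hx hy => rw [smul_add, hx, hy, add_zero]

/-- A map `M → P` to a module killed by `ħ^n` factors through `M/ħ^n M`. -/
def Red.lift (n : ℕ) (f : M →ₗ[Ch] P) (hP : ∀ x : P, hbar ^ n • x = 0) : Red n M →ₗ[Ch] P :=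
  (hpow n M).liftQ f (hpow_le_ker f hP)

/-- The map `M^ → M/ħ^n M` on the completion of `M`. -/
def evalRed (n : ℕ) (M : Type*) [AddCommGroup M] [Module Ch M] :
    AdicCompletion hI M →ₗ[Ch] Red n M :=
  AdicCompletion.eval hI M n

/-- A map `M ⊗ N → P` to a module killed by `ħ^n` factors through `M/ħ^n M ⊗ N/ħ^n N`. -/
def redLift (n : ℕ) (f : M ⊗[Ch] N →ₗ[Ch] P) (hP : ∀ x : P, hbar ^ n • x = 0) :
    Red n M ⊗[Ch] Red n N →ₗ[Ch] P :=
  let g : Red n M →ₗ[Ch] N →ₗ[Ch] P :=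
    Red.lift n (TensorProduct.curry f) fun φ => by ext x; simp [hP]
  TensorProduct.lift (Red.lift n g.flip fun φ => by ext x; simp [hP]).flip

end Reductions

section Operators

/-- The completed tensor product `V ⊗̂ V`, i.e. `(V₀ ⊗ V₀)[[ħ]]` for `V = V₀[[ħ]]`. -/
abbrev CT (V : Type*) [AddCommGroup V] [Module Ch V] : Type _ :=
  AdicCompletion hI (V ⊗[Ch] V)

/-- The completed tensor product `V ⊗̂ V ⊗̂ ℂ((z))[[ħ]]`, i.e. `(V₀ ⊗ V₀ ⊗ ℂ((z)))[[ħ]]` for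
`V = V₀[[ħ]]`. -/
abbrev CTL (V : Type*) [AddCommGroup V] [Module Ch V] : Type _ :=
  AdicCompletion hI ((V ⊗[Ch] V) ⊗[Ch] LauH)

variable {V : Type*} [AddCommGroup V] [Module Ch V]

/-- `U ⊗̂ U` for a subset `U` of `V`: the closed `ℂ[[ħ]]`-span of all `u ⊗ v` with `u, v ∈ U`. -/
def closedTensor (U : Set V) : Submodule Ch (CT V) :=
  hClosure (Submodule.span Ch
    {x | ∃ u ∈ U, ∃ v ∈ U, x = AdicCompletion.of hI _ (u ⊗ₜ[Ch] v)})

/-- `U ⊗̂ U ⊗̂ ℂ((z))[[ħ]]` for a subset `U` of `V`: the closed `ℂ[[ħ]]`-span of all `u ⊗ v ⊗ f`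
with `u, v ∈ U` and `f ∈ ℂ((z))[[ħ]]`. -/
def closedTensorLau (U : Set V) : Submodule Ch (CTL V) :=
  hClosure (Submodule.span Ch
    {x | ∃ u ∈ U, ∃ v ∈ U, ∃ f : LauH, x = AdicCompletion.of hI _ ((u ⊗ₜ[Ch] v) ⊗ₜ[Ch] f)})

/-- The reduction modulo `ħ^n`, from `V ⊗̂ V ⊗̂ ℂ((z))[[ħ]]` to
`V/ħ^n V ⊗ V/ħ^n V ⊗ ℂ((z))[[ħ]]`. -/
def redCTL (n : ℕ) : CTL V →ₗ[Ch] (Red n V ⊗[Ch] Red n V) ⊗[Ch] LauH :=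
  Red.lift n (LinearMap.rTensor LauH (TensorProduct.map (red n V) (red n V)))
    (smul_tensor (smul_tensor smul_red)) ∘ₗ evalRed n ((V ⊗[Ch] V) ⊗[Ch] LauH)

/-- The map `V/ħ^n V ⊗ V/ħ^n V → V/ħ^n V ⊗ V/ħ^n V ⊗ ℂ((z))[[ħ]]` induced by
`S(z) : V ⊗̂ V → V ⊗̂ V ⊗̂ ℂ((z))[[ħ]]`. -/
def redS (S : CT V →ₗ[Ch] CTL V) (n : ℕ) :
    Red n V ⊗[Ch] Red n V →ₗ[Ch] (Red n V ⊗[Ch] Red n V) ⊗[Ch] LauH :=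
  redLift n (redCTL n ∘ₗ S ∘ₗ AdicCompletion.of hI (V ⊗[Ch] V))
    (smul_tensor (smul_tensor smul_red))

variable {M M' : Type*} [AddCommGroup M] [Module Ch M] [AddCommGroup M'] [Module Ch M']

/-- For an operator `G(z) : M → M' ⊗ ℂ((z))[[ħ]]` and a substitution `φ : ℂ((z)) → R`, the
`R[[ħ]]`-linear extension `M ⊗ R[[ħ]] → M' ⊗ R[[ħ]]` of `(1 ⊗ φ) G`: if `G m = ∑ m_s ⊗ f_s`, then
`m ⊗ r ↦ ∑ m_s ⊗ φ(f_s) r`. -/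
def extend {R : Type} [CommRing R] [Algebra ℂ R] (φ : Lau →ₗ[ℂ] R)
    (G : M →ₗ[Ch] M' ⊗[Ch] LauH) : M ⊗[Ch] PSH R →ₗ[Ch] M' ⊗[Ch] PSH R :=
  LinearMap.lTensor M' (LinearMap.mul' Ch (PSH R) ∘ₗ LinearMap.rTensor (PSH R) (PSH.map φ))
  ∘ₗ (TensorProduct.assoc Ch M' LauH (PSH R)).toLinearMap
  ∘ₗ LinearMap.rTensor (PSH R) G

/-- Transport of an operator `G(z) : M → M ⊗ ℂ((z))[[ħ]]` along an isomorphism `σ : M → M'`. -/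
def conj (σ : M ≃ₗ[Ch] M') (G : M →ₗ[Ch] M ⊗[Ch] LauH) : M' →ₗ[Ch] M' ⊗[Ch] LauH :=
  LinearMap.rTensor LauH σ.toLinearMap ∘ₗ G ∘ₗ σ.symm.toLinearMap

/-- `G^{21}(z)`. -/
def op21 (G : M ⊗[Ch] M →ₗ[Ch] (M ⊗[Ch] M) ⊗[Ch] LauH) :
    M ⊗[Ch] M →ₗ[Ch] (M ⊗[Ch] M) ⊗[Ch] LauH :=
  conj (TensorProduct.comm Ch M M) G

/-- `G^{12}(z)`. -/
def op12 (G : M ⊗[Ch] M →ₗ[Ch] (M ⊗[Ch] M) ⊗[Ch] LauH) :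
    (M ⊗[Ch] M) ⊗[Ch] M →ₗ[Ch] ((M ⊗[Ch] M) ⊗[Ch] M) ⊗[Ch] LauH :=
  (TensorProduct.rightComm Ch (M ⊗[Ch] M) LauH M).toLinearMap ∘ₗ LinearMap.rTensor M G

/-- The permutation `(a ⊗ b) ⊗ c ↦ (a ⊗ c) ⊗ b`. -/
def perm13 : (M ⊗[Ch] M) ⊗[Ch] M ≃ₗ[Ch] (M ⊗[Ch] M) ⊗[Ch] M :=
  TensorProduct.rightComm Ch M M M

/-- The permutation `(a ⊗ b) ⊗ c ↦ (c ⊗ a) ⊗ b`. -/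
def perm23 : (M ⊗[Ch] M) ⊗[Ch] M ≃ₗ[Ch] (M ⊗[Ch] M) ⊗[Ch] M :=
  TensorProduct.comm Ch (M ⊗[Ch] M) M ≪≫ₗ (TensorProduct.assoc Ch M M M).symm

/-- `G^{13}(z)`. -/
def op13 (G : M ⊗[Ch] M →ₗ[Ch] (M ⊗[Ch] M) ⊗[Ch] LauH) :
    (M ⊗[Ch] M) ⊗[Ch] M →ₗ[Ch] ((M ⊗[Ch] M) ⊗[Ch] M) ⊗[Ch] LauH :=
  conj perm13 (op12 G)

/-- `G^{23}(z)`. -/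
def op23 (G : M ⊗[Ch] M →ₗ[Ch] (M ⊗[Ch] M) ⊗[Ch] LauH) :
    (M ⊗[Ch] M) ⊗[Ch] M →ₗ[Ch] ((M ⊗[Ch] M) ⊗[Ch] M) ⊗[Ch] LauH :=
  conj perm23 (op12 G)

/-- The coefficient of `y^q x^p` of an element of `M ⊗ ℂ((x))((y))[[ħ]]`. -/
def coeffAt (q p : ℤ) : M ⊗[Ch] Lau2H →ₗ[Ch] M :=
  (TensorProduct.rid Ch M).toLinearMap ∘ₗ
    LinearMap.lTensor M (PSH.toCh ∘ₗ PSH.map (Lau.coeff p ∘ₗ Lau2.coeff q))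

end Operators

/-! ### `ħ`-adic quantum vertex algebras -/

namespace NonlocalVA

variable {V : Type*} [AddCommGroup V] [Module Ch V] [TopFree V] (A : NonlocalVA V)

/-- The coefficient of `z^k` in `Y(z)`, modulo `ħ^n`. -/
def redY (n : ℕ) (k : ℤ) : Red n V ⊗[Ch] Red n V →ₗ[Ch] Red n V :=
  redLift n (red n V ∘ₗ A.Ycoeff k) smul_red

/-- The derivation `∂`, modulo `ħ^n`. -/
def redDer (n : ℕ) : Red n V →ₗ[Ch] Red n V :=
  Red.lift n (red n V ∘ₗ A.der) smul_red

/-- The map `v ⊗ u ↦ v_{(p)} u_{(q)} w`, modulo `ħ^n`, where `v_{(p)}` is the coefficient of `z^p`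
in `Y(v, z)`. -/
def redYY (n : ℕ) (w : V) (p q : ℤ) : Red n V ⊗[Ch] Red n V →ₗ[Ch] Red n V :=
  redLift n (red n V ∘ₗ A.Ycoeff p ∘ₗ
    LinearMap.lTensor V (LinearMap.proj q ∘ₗ A.Y.flip w)) smul_red

/-- The coefficient of `z_1^{e 0} z_2^{e 1}`, modulo `ħ^n`, of
`Y(z_2)(1 ⊗ Y(z_1)) G(z_2 - z_1)(v ⊗ u) w`, where `G(z_2 - z_1)` is expanded in nonnegative powers
of `z_1`. Only finitely many terms of the sum are nonzero. -/
def oppositeSeries (n : ℕ)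
    (G : Red n V ⊗[Ch] Red n V →ₗ[Ch] (Red n V ⊗[Ch] Red n V) ⊗[Ch] LauH)
    (u v w : V) (e : Fin 2 → ℤ) : Red n V :=
  ∑ᶠ qp : ℤ × ℤ, A.redYY n w (e 1 - qp.2) (e 0 - qp.1)
    (coeffAt qp.1 qp.2
      (LinearMap.lTensor _ (PSH.map (taylor (-1))) (G (red n V v ⊗ₜ[Ch] red n V u))))

/-- The coefficient of `y^c` of `Y^{12}(y) T(x, y)`, for `T ∈ (V ⊗ V ⊗ V) ⊗ ℂ((x))((y))[[ħ]]`
modulo `ħ^n`. Only finitely many terms of the sum are nonzero. -/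
def Y12 (n : ℕ) (T : ((Red n V ⊗[Ch] Red n V) ⊗[Ch] Red n V) ⊗[Ch] Lau2H) (c : ℤ) :
    (Red n V ⊗[Ch] Red n V) ⊗[Ch] LauH :=
  ∑ᶠ k : ℤ, TensorProduct.map (LinearMap.rTensor (Red n V) (A.redY n k))
    (PSH.map (Lau2.coeff (c - k))) T

end NonlocalVA

/-- An `ħ`-adic quantum vertex algebra: an `ħ`-adic nonlocal vertex algebra with a quantum
Yang–Baxter operator `S(z)`. Identities between maps into completed modules are stated modulo
`ħ^n` for all `n`. -/
structure QuantumVA (V : Type*) [AddCommGroup V] [Module Ch V] [TopFree V] extends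
    NonlocalVA V where
  S : CT V →ₗ[Ch] CTL V
  /-- `[∂ ⊗ 1, S(z)] = -d/dz S(z)` -/
  shift : ∀ (n : ℕ) (t : Red n V ⊗[Ch] Red n V),
    LinearMap.rTensor LauH (LinearMap.rTensor (Red n V) (toNonlocalVA.redDer n)) (redS S n t)
      - redS S n (LinearMap.rTensor (Red n V) (toNonlocalVA.redDer n) t)
      = - LinearMap.lTensor _ (PSH.map (Lau.hasseDeriv 1)) (redS S n t)
  /-- `S^{12}(x) S^{13}(x + y) S^{23}(y) = S^{23}(y) S^{13}(x + y) S^{12}(x)` -/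
  yangBaxter : ∀ n : ℕ,
    extend atInner (op12 (redS S n)) ∘ₗ extend (taylor 1) (op13 (redS S n))
        ∘ₗ extend atOuter (op23 (redS S n))
      = extend atOuter (op23 (redS S n)) ∘ₗ extend (taylor 1) (op13 (redS S n))
        ∘ₗ extend atInner (op12 (redS S n))
  /-- `S^{21}(z) S(-z) = 1` -/
  unitarity : ∀ n : ℕ,
    extend LinearMap.id (op21 (redS S n)) ∘ₗ extend atNeg (redS S n) = LinearMap.id
  /-- `S(z)(𝟙 ⊗ v) = 𝟙 ⊗ v` -/
  S_vac : ∀ v : V, S (AdicCompletion.of hI _ (vac ⊗ₜ[Ch] v))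
      = AdicCompletion.of hI _ ((vac ⊗ₜ[Ch] v) ⊗ₜ[Ch] (1 : LauH))
  /-- `Y(u, z_1) Y(v, z_2) ∼ Y(z_2)(1 ⊗ Y(z_1)) S(z_2 - z_1)(v ⊗ u)` -/
  locality : ∀ (u v : V) (n : ℕ), ∃ k : ℕ, ∀ w : V,
    polyMul (diffProd 2 k) (fun e => red n V (iter ![Y u, Y v] w e))
      = polyMul (diffProd 2 k) (toNonlocalVA.oppositeSeries n (redS S n) u v w)
  /-- `S(x) Y^{12}(y) = Y^{12}(y) S^{23}(x) S^{13}(x + y)` -/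
  hexagon : ∀ (n : ℕ) (t : (Red n V ⊗[Ch] Red n V) ⊗[Ch] Red n V) (c : ℤ),
    redS S n (LinearMap.rTensor (Red n V) (toNonlocalVA.redY n c) t)
      = toNonlocalVA.Y12 n
          (extend atInner (op23 (redS S n)) (extend (taylor 1) (op13 (redS S n))
            (t ⊗ₜ[Ch] (1 : Lau2H)))) c

/-- `S(z)(U ⊗̂ U) ⊆ U ⊗̂ U ⊗̂ ℂ((z))[[ħ]]`. -/
def QuantumVA.IsSClosed {V : Type*} [AddCommGroup V] [Module Ch V] [TopFree V]
    (A : QuantumVA V) (U : Set V) : Prop :=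
  ∀ t ∈ closedTensor U, A.S t ∈ closedTensorLau U

end HAdic

end

/-! Let `K` be the space of vectors `v` with `Y_W(v, z)w⁺` regular, and `N ⊆ K` the space of those
`v ∈ K` for which `S(z)(v ⊗ u)` has its second leg in `K` for all `u ∈ U`, modulo every `ħ^n`. The
point is that every mode of every `u ∈ U` preserves `N`. The vectors whose modes preserve `N` form a
closed saturated subspace that contains `𝟙` and is stable under all products, by associativity. So
this subspace is `V`, and since `𝟙 ∈ N`, each `u = u_{-1}𝟙` lies in `N ⊆ K`.

Let `u ∈ U` and `v ∈ N`. The condition on `S` passes to `u_m v` by the hexagon identity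
(`redS_Y_mem`): in `Y^{12}(y) S^{23}(x) S^{13}(x + y)(u ⊗ v ⊗ u')` the factor `S^{13}` leaves the
third leg in `U` because `U` is `S`-closed, and `S^{23}` then moves it into `K` because `v ∈ N`.

Regularity of `Y_W(u_m v, z)w⁺` (`Y_Y_regular`) takes two steps modulo `ħ^n`. By associativity
`Y_W(Y(u, x)v, z)w⁺ = x^{-m} F(z + x, z)`, where `F(x, y) = (x - y)^m Y_W(u, x)Y_W(v, y)w⁺` is
regular in `y`. A negative power of `z + x`, expanded in nonnegative powers of `x`, has poles in `z`
of unbounded order. Hence if the poles of `F(z + x, z)` in `z` are bounded uniformly in the power of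
`x`, then `F` is regular in `x` too and there are no poles at all (`translate_regular`).

The uniform bound (`exists_pole_bound`) comes from `S`-locality on `𝟙`, at `z_2 = 0`: up to powers
of `z_1 - z_2` it rewrites `Y(u, z_1)v` through terms `Y(v', z_2)Y(u', z_1)𝟙` with `u' ∈ K`. For
these, `subMul_iterCoeff` gives `G(z, z + z_1)` with `G` regular in its second variable, so the
poles in `z` are at most those of `G` in its first variable.

Saturation of `N` is the point where flatness over `ℂ[[ħ]]` enters (`redCTL_mem_of_smul`). -/

open scoped TensorProduct

noncomputable section

namespace HAdic

/-! ### Double arrays and binomial substitutions -/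

section Arrays

variable {M : Type*} [AddCommGroup M]

/-- Multiplication by `x - y` of the series whose coefficient of `x^p y^q` is `F p q`. -/
def subMul (F : ℤ → ℤ → M) : ℤ → ℤ → M := fun p q => F (p - 1) q - F p (q - 1)

/-! ### Two-variable `polyMul` as an iterated difference operator -/

theorem polyMul_eq_sum {σ : Type*} {p : MvPolynomial σ ℤ} {s : Finset (σ →₀ ℕ)}
    (h : p.support ⊆ s) (A : (σ → ℤ) → M) (e : σ → ℤ) :
    polyMul p A e = ∑ d ∈ s, p.coeff d • A fun i => e i - (d i : ℤ) :=
  Finset.sum_subset h fun d _ hd => by rw [MvPolynomial.notMem_support_iff.1 hd, zero_smul]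

theorem polyMul_add {σ : Type*} (p p' : MvPolynomial σ ℤ) (A : (σ → ℤ) → M) :
    polyMul (p + p') A = polyMul p A + polyMul p' A := by
  classical
  funext e
  rw [Pi.add_apply, polyMul_eq_sum MvPolynomial.support_add,
    polyMul_eq_sum (Finset.subset_union_left (s₂ := p'.support)),
    polyMul_eq_sum (Finset.subset_union_right (s₁ := p.support)), ← Finset.sum_add_distrib]
  exact Finset.sum_congr rfl fun d _ => by rw [MvPolynomial.coeff_add, add_smul]

theorem polyMul_monomial {σ : Type*} (d : σ →₀ ℕ) (c : ℤ) (A : (σ → ℤ) → M) (e : σ → ℤ) :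
    polyMul (MvPolynomial.monomial d c) A e = c • A fun i => e i - (d i : ℤ) := by
  classical
  rw [polyMul_eq_sum MvPolynomial.support_monomial_subset, Finset.sum_singleton,
    MvPolynomial.coeff_monomial, if_pos rfl]

theorem polyMul_X_mul {σ : Type*} [DecidableEq σ] (j : σ) (p : MvPolynomial σ ℤ)
    (A : (σ → ℤ) → M) (e : σ → ℤ) :
    polyMul (MvPolynomial.X j * p) A e = polyMul p A (e - Pi.single j 1) := by
  induction p using MvPolynomial.induction_on' with
  | monomial d c =>
    rw [MvPolynomial.X, MvPolynomial.monomial_mul, polyMul_monomial, polyMul_monomial, one_mul]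
    congr 2
    funext i
    by_cases h : i = j
    · subst h; simp; ring
    · simp [h]
  | add p p' hp hp' => rw [mul_add, polyMul_add, polyMul_add, Pi.add_apply, hp, hp', Pi.add_apply]

theorem polyMul_one {σ : Type*} (A : (σ → ℤ) → M) : polyMul 1 A = A := by
  funext e
  have := polyMul_monomial (0 : σ →₀ ℕ) 1 A e
  simpa using this

theorem polyMul_neg {σ : Type*} (p : MvPolynomial σ ℤ) (A : (σ → ℤ) → M) :
    polyMul (-p) A = - polyMul p A := by
  have h0 : polyMul (0 : MvPolynomial σ ℤ) A = 0 := by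
    funext e
    simp [polyMul]
  have := polyMul_add p (-p) A
  rw [add_neg_cancel, h0] at this
  exact (neg_eq_of_add_eq_zero_right this.symm).symm

theorem vec_eq (e : Fin 2 → ℤ) : e = ![e 0, e 1] := by
  funext i; fin_cases i <;> rfl

theorem polyMul_diffProd (k : ℕ) (A : (Fin 2 → ℤ) → M) (p q : ℤ) :
    polyMul (diffProd 2 k) A ![p, q] = subMul^[k] (fun p q => A ![p, q]) p q := by
  have hd : ∀ k, diffProd 2 k = (MvPolynomial.X 0 - MvPolynomial.X 1) ^ k := by
    intro k
    have h0 : Finset.Ioi (0 : Fin 2) = {1} := by decide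
    have h1 : Finset.Ioi (1 : Fin 2) = ∅ := by decide
    simp [diffProd, Fin.prod_univ_two, h0, h1]
  rw [hd]
  induction k generalizing p q with
  | zero => simp [polyMul_one]
  | succ k ih =>
    have e0 : (![p, q] : Fin 2 → ℤ) - Pi.single 0 1 = ![p - 1, q] := by
      funext i; fin_cases i <;> simp
    have e1 : (![p, q] : Fin 2 → ℤ) - Pi.single 1 1 = ![p, q - 1] := by
      funext i; fin_cases i <;> simp
    rw [pow_succ', sub_eq_add_neg, add_mul, neg_mul, polyMul_add, polyMul_neg, Pi.add_apply,
      Pi.neg_apply, polyMul_X_mul, polyMul_X_mul, e0, e1, ← sub_eq_add_neg,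
      Function.iterate_succ_apply', subMul, ← sub_eq_add_neg, ih, ih]

theorem subMul_iterate_eqOn {F F' : ℤ → ℤ → M} {a b : ℤ}
    (h : ∀ p q, p ≤ a → q ≤ b → F p q = F' p q) (k : ℕ) :
    ∀ p q, p ≤ a → q ≤ b → subMul^[k] F p q = subMul^[k] F' p q := by
  induction k with
  | zero => exact h
  | succ k ih =>
    intro p q hp hq
    rw [Function.iterate_succ_apply', Function.iterate_succ_apply', subMul, subMul,
      ih _ _ (by omega) hq, ih _ _ hp (by omega)]

theorem subMul_iterate_left_zero {F : ℤ → ℤ → M} {N : ℤ} (h : ∀ p q, p < N → F p q = 0)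
    (k : ℕ) : ∀ p q, p < N → subMul^[k] F p q = 0 := by
  induction k with
  | zero => exact h
  | succ k ih =>
    intro p q hp
    rw [Function.iterate_succ_apply', subMul, ih _ _ (by omega), ih _ _ hp, sub_zero]

theorem subMul_iterate_right_zero {F : ℤ → ℤ → M} {N : ℤ} (h : ∀ p q, q < N → F p q = 0)
    (k : ℕ) : ∀ p q, q < N → subMul^[k] F p q = 0 := by
  induction k with
  | zero => exact h
  | succ k ih =>
    intro p q hq
    rw [Function.iterate_succ_apply', subMul, ih _ _ hq, ih _ _ (by omega), sub_zero]

/-- At the lowest power of `y` only the term `x^k` of `(x - y)^k` contributes. This is how `y = 0`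
is substituted later. -/
theorem subMul_iterate_zero_right {F : ℤ → ℤ → M} (h : ∀ p q, q < 0 → F p q = 0) (k : ℕ)
    (p : ℤ) : subMul^[k] F p 0 = F (p - k) 0 := by
  induction k generalizing p with
  | zero => simp
  | succ k ih =>
    rw [Function.iterate_succ_apply', subMul, subMul_iterate_right_zero h k p _ (by omega), ih,
      sub_zero]
    congr 1; push_cast; ring

theorem subMul_iterate_swap (F : ℤ → ℤ → M) (k : ℕ) (p q : ℤ) :
    subMul^[k] (fun p q => F q p) p q = (-1 : ℤ) ^ k • subMul^[k] F q p := by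
  induction k generalizing p q with
  | zero => simp
  | succ k ih =>
    rw [Function.iterate_succ_apply', Function.iterate_succ_apply', subMul, ih, ih, subMul,
      ← smul_sub, pow_succ, mul_smul, neg_one_smul, neg_sub]

theorem subMul_iterate_map {M' G : Type*} [AddCommGroup M'] [FunLike G M M']
    [AddMonoidHomClass G M M'] (φ : G) (F : ℤ → ℤ → M) (k : ℕ) (p q : ℤ) :
    φ (subMul^[k] F p q) = subMul^[k] (fun p q => φ (F p q)) p q := by
  induction k generalizing p q with
  | zero => rfl
  | succ k ih =>
    rw [Function.iterate_succ_apply', Function.iterate_succ_apply', subMul, subMul, map_sub, ih, ih]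

theorem subMul_iterate_add (F F' : ℤ → ℤ → M) (k : ℕ) :
    subMul^[k] (F + F') = subMul^[k] F + subMul^[k] F' := by
  induction k with
  | zero => rfl
  | succ k ih =>
    rw [Function.iterate_succ_apply', Function.iterate_succ_apply', Function.iterate_succ_apply',
      ih]
    funext p q
    simp only [subMul, Pi.add_apply]; abel

/-- The coefficients of the derivative with respect to the second variable. -/
def derivRight (F : ℤ → ℤ → M) : ℤ → ℤ → M := fun p q => (q + 1) • F p (q + 1)

/-- The Leibniz rule for `∂_y`, with `∂_y (x - y)^{k+1} = -(k+1)(x - y)^k`. -/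
theorem derivRight_subMul_iterate (F : ℤ → ℤ → M) (k : ℕ) (p q : ℤ) :
    derivRight (subMul^[k + 1] F) p q
      = subMul^[k + 1] (derivRight F) p q - ((k : ℤ) + 1) • subMul^[k] F p q := by
  have base : ∀ F : ℤ → ℤ → M, ∀ p q,
      derivRight (subMul F) p q = subMul (derivRight F) p q - F p q := by
    intro F p q
    simp only [derivRight, subMul, sub_add_cancel, add_sub_cancel_right]
    module
  induction k generalizing p q with
  | zero => simp [base]
  | succ k ih =>
    have e : ∀ (G : ℤ → ℤ → M) (k : ℕ),
        subMul^[k + 1] G p q = subMul^[k] G (p - 1) q - subMul^[k] G p (q - 1) := fun G k => by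
      rw [Function.iterate_succ_apply', subMul]
    rw [Function.iterate_succ_apply', base, subMul, ih, ih, e _ (k + 1), e F]
    push_cast
    module

/-! ### The substitution `(z + x, z + y)` and translation invariance -/

/-- The binomial coefficient `p choose a`, which is `0` for `a < 0`. -/
def intChoose (p a : ℤ) : ℤ := if 0 ≤ a then Ring.choose p a.toNat else 0

theorem intChoose_of_neg {p a : ℤ} (h : a < 0) : intChoose p a = 0 := if_neg (by omega)

theorem intChoose_natCast (p : ℤ) (r : ℕ) : intChoose p r = Ring.choose p r := by
  simp [intChoose]

@[simp]
theorem intChoose_zero_right (p : ℤ) : intChoose p 0 = 1 := by simp [intChoose]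

@[simp]
theorem intChoose_one_right (p : ℤ) : intChoose p 1 = p := by simp [intChoose]

theorem intChoose_eq_zero {p a : ℤ} (h : 0 ≤ p) (h' : p < a) : intChoose p a = 0 := by
  lift p to ℕ using h
  lift a to ℕ using by omega
  rw [intChoose_natCast, Ring.choose_natCast, Nat.choose_eq_zero_of_lt (by omega), Nat.cast_zero]

theorem succ_mul_intChoose (p a : ℤ) :
    (a + 1) * intChoose p (a + 1) = (p - a) * intChoose p a := by
  rcases lt_trichotomy a (-1) with h | rfl | h
  · simp [intChoose_of_neg (show a < 0 by omega), intChoose_of_neg (show a + 1 < 0 by omega)]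
  · simp [intChoose_of_neg (show (-1 : ℤ) < 0 by omega)]
  · lift a to ℕ using by omega
    have e : (a : ℤ) + 1 = (a + 1 : ℕ) := by push_cast; ring
    rw [e, intChoose_natCast, intChoose_natCast]
    have h1 := Ring.choose_smul_choose p (show a ≤ a + 1 by omega)
    rw [Nat.choose_succ_self_right, Nat.add_sub_cancel_left, Ring.choose_one_right,
      nsmul_eq_mul] at h1
    rw [h1, mul_comm]

theorem intChoose_succ_right_self {q : ℤ} (hq : 0 ≤ q) : intChoose (q + 1) q = q + 1 := by
  lift q to ℕ using hq
  have e : (q : ℤ) + 1 = (q + 1 : ℕ) := by push_cast; ring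
  rw [e, intChoose_natCast, Ring.choose_natCast, Nat.choose_succ_self_right]

/-- The coefficient of `x^a y^b z^c` in `F(z + x, z + y)`, expanded in nonnegative powers of `x`
and `y`. -/
def translate (F : ℤ → ℤ → M) (a b c : ℤ) : M :=
  ∑ᶠ p : ℤ, (intChoose p a * intChoose (a + b + c - p) b) • F p (a + b + c - p)

/-- The series has only finitely many negative powers of both variables. -/
def BddBelowBy (N : ℤ) (F : ℤ → ℤ → M) : Prop := ∀ p q, p < N ∨ q < N → F p q = 0

theorem BddBelowBy.subMul_iterate {F : ℤ → ℤ → M} {N : ℤ} (h : BddBelowBy N F) (k : ℕ) :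
    BddBelowBy N (subMul^[k] F) := by
  rintro p q (hp | hq)
  · exact subMul_iterate_left_zero (fun p q hp => h p q (Or.inl hp)) k p q hp
  · exact subMul_iterate_right_zero (fun p q hp => h p q (Or.inr hp)) k p q hq

theorem translate_eq_sum {F : ℤ → ℤ → M} {N : ℤ} (h : BddBelowBy N F) {a b c d : ℤ}
    (hd : a + b + c = d) :
    translate F a b c
      = ∑ p ∈ Finset.Icc N (d - N), (intChoose p a * intChoose (d - p) b) • F p (d - p) := by
  subst hd
  refine finsum_eq_sum_of_support_subset _ fun p hp => ?_
  rw [Finset.coe_Icc, Set.mem_Icc]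
  by_contra hcon
  refine hp ?_
  dsimp only
  rw [h _ _ (by omega), smul_zero]

/-- The invariance of the coefficients `Y a b c` of a series in `x`, `y`, `z` under
`∂_x + ∂_y - ∂_z`. -/
def TranslationInvariant (Y : ℤ → ℤ → ℤ → M) : Prop :=
  ∀ a b c, (b + 1) • Y a (b + 1) c = (c + 1) • Y a b (c + 1) - (a + 1) • Y (a + 1) b c

/-- The chain rule. On the monomial `x^p y^q` with `p + q = a + b + c + 1` it is the identity `c + 1
= (p - a) + (q - b)`, combined with `(a + 1) (p choose a + 1) = (p - a) (p choose a)`. -/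
theorem translationInvariant_translate {F : ℤ → ℤ → M} {N : ℤ} (h : BddBelowBy N F) :
    TranslationInvariant (translate F) := by
  intro a b c
  rw [translate_eq_sum h (show a + (b + 1) + c = a + b + c + 1 by ring),
    translate_eq_sum h (show a + b + (c + 1) = a + b + c + 1 by ring),
    translate_eq_sum h (show a + 1 + b + c = a + b + c + 1 by ring),
    Finset.smul_sum, Finset.smul_sum, Finset.smul_sum, ← Finset.sum_sub_distrib]
  refine Finset.sum_congr rfl fun p _ => ?_
  simp only [smul_smul, ← sub_smul]
  congr 1
  have h1 := succ_mul_intChoose (a + b + c + 1 - p) b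
  have h2 := succ_mul_intChoose p a
  linear_combination (intChoose p a) * h1 + (intChoose (a + b + c + 1 - p) b) * h2

theorem TranslationInvariant.subMul {Y : ℤ → ℤ → ℤ → M} (h : TranslationInvariant Y) :
    TranslationInvariant (subMul Y) := by
  intro a b c
  have h1 := h (a - 1) b c
  have h2 := h a (b - 1) c
  simp only [HAdic.subMul, Pi.sub_apply, smul_sub, sub_add_cancel, add_sub_cancel_right]
    at h1 h2 ⊢
  rw [h1, add_smul b, h2]
  module

theorem TranslationInvariant.subMul_iterate {Y : ℤ → ℤ → ℤ → M} (h : TranslationInvariant Y)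
    (k : ℕ) : TranslationInvariant (HAdic.subMul^[k] Y) := by
  induction k with
  | zero => exact h
  | succ k ih => rw [Function.iterate_succ_apply']; exact ih.subMul

/-- Invariance is a recursion in the power of `y`: it determines `b + 1` times the coefficient at `b
+ 1` from those at `b`. So the value at `y = 0` determines the series when integers act without
torsion. -/
theorem TranslationInvariant.ext {Y Y' : ℤ → ℤ → ℤ → M}
    (htor : ∀ (j : ℤ) (x : M), j ≠ 0 → j • x = 0 → x = 0)
    (h : TranslationInvariant Y) (h' : TranslationInvariant Y')
    (hneg : ∀ a b c, b < 0 → Y a b c = 0) (hneg' : ∀ a b c, b < 0 → Y' a b c = 0)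
    (h0 : ∀ a c, Y a 0 c = Y' a 0 c) : Y = Y' := by
  have key : ∀ (n : ℕ) a c, Y a n c = Y' a n c := by
    intro n
    induction n with
    | zero => exact h0
    | succ n ih =>
      intro a c
      have e := h a n c
      have e' := h' a n c
      rw [ih, ih, ← e'] at e
      push_cast
      rw [← sub_eq_zero] at e ⊢
      rw [← smul_sub] at e
      exact htor _ _ (by omega) e
  funext a b c
  rcases lt_or_ge b 0 with hb | hb
  · rw [hneg _ _ _ hb, hneg' _ _ _ hb]
  · lift b to ℕ using hb
    exact key b a c

theorem translate_of_neg (F : ℤ → ℤ → M) {a b : ℤ} (c : ℤ) (h : a < 0 ∨ b < 0) :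
    translate F a b c = 0 := by
  refine finsum_eq_zero_of_forall_eq_zero fun p => ?_
  rcases h with h | h <;> simp [intChoose_of_neg h]

/-- A series in nonnegative powers of the second variable has no powers of `z` below its bound
for the first variable after the substitution `(z, z + y)`. -/
theorem translate_zero_left_eq_zero {F : ℤ → ℤ → M} {N : ℤ} (hp : ∀ p q, p < N → F p q = 0)
    (hq : ∀ p q, q < 0 → F p q = 0) {b c : ℤ} (hc : c < N) : translate F 0 b c = 0 := by
  refine finsum_eq_zero_of_forall_eq_zero fun p => ?_
  by_cases h1 : p < N
  · rw [hp _ _ h1, smul_zero]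
  · by_cases h2 : 0 + b + c - p < 0
    · rw [hq _ _ h2, smul_zero]
    · rw [intChoose_eq_zero (a := b) (by omega) (by omega), mul_zero, zero_smul]

/-- If `∑ h_i (1 + t)^{-(i+1)}` is a polynomial in `t`, then all `h_i` vanish. Multiplying by `1 +
t` (Pascal's rule) lowers each exponent and turns the term `i = 0` into a constant, invisible in
positive degrees, so induction applies. The remaining coefficient is `±h_0`, hence no assumption on
torsion. -/
theorem eq_zero_of_sum_choose_neg (N : ℕ) (h : ℕ → M) (R : ℕ)
    (hs : ∀ r : ℕ, R ≤ r → ∑ i ∈ Finset.range N, Ring.choose (-(i + 1 : ℤ)) r • h i = 0) :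
    ∀ i < N, h i = 0 := by
  induction N generalizing h R with
  | zero => intro i hi; omega
  | succ N ih =>
    have hstep : ∀ i < N, h (i + 1) = 0 := by
      refine ih (fun i => h (i + 1)) (R + 1) fun r hr => ?_
      obtain ⟨r, rfl⟩ : ∃ s, r = s + 1 := ⟨r - 1, by omega⟩
      have e1 := hs (r + 1) (by omega)
      have e2 := hs r (by omega)
      have e3 := congrArg₂ (· + ·) e2 e1
      simp only [← Finset.sum_add_distrib, ← add_smul, ← Ring.choose_succ_succ, add_zero] at e3
      rw [Finset.sum_range_succ'] at e3
      simp only [Nat.cast_zero, zero_add, neg_add_cancel, Ring.choose_zero_succ, zero_smul,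
        add_zero] at e3
      rw [← e3]
      refine Finset.sum_congr rfl fun i _ => ?_
      congr 2
    intro i hi
    rcases i with _ | i
    · have e := hs R le_rfl
      rw [Finset.sum_range_succ', Finset.sum_eq_zero fun i hi => by
        rw [hstep i (Finset.mem_range.1 hi), smul_zero], zero_add] at e
      have hu : Ring.choose (-((0 : ℕ) + 1 : ℤ)) R = (-1 : ℤ) ^ R := by
        rw [Nat.cast_zero, zero_add, Ring.choose_neg]
        simp [Ring.choose_natCast, Int.negOnePow_def, Units.smul_def]
      rw [hu] at e
      have := congrArg ((-1 : ℤ) ^ R • ·) e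
      simpa [smul_smul, ← mul_pow] using this
    · exact hstep i (by omega)

/-- If `F(z + x, z)`, with `F` regular in the second variable, has only finitely many negative
powers of `z`, then `F` is regular in the first variable as well and `F(z + x, z)` is regular
in `z`. -/
theorem translate_regular {F : ℤ → ℤ → M} {N N₀ : ℤ} (hF : BddBelowBy N F)
    (hq : ∀ p q, q < 0 → F p q = 0) (h : ∀ a c, c < N₀ → translate F a 0 c = 0) {a c : ℤ}
    (hc : c < 0) : translate F a 0 c = 0 := by
  have hneg : ∀ d p, p < 0 → F p (d - p) = 0 := by
    intro d p hp
    by_cases hpN : p < N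
    · exact hF _ _ (Or.inl hpN)
    -- The bound on `r` ensures `r > d`, so nonnegative `p` contribute nothing (either `p > d` or `p
    -- choose r = 0`), and `d - r < N₀`, so the coefficient of `x^r z^{d-r}` vanishes by hypothesis.
    -- What remains is a relation among the finitely many negative `p ≥ N`.
    have key := eq_zero_of_sum_choose_neg (-N).toNat
      (fun i => F (-(i + 1 : ℤ)) (d + (i + 1))) (max (d + 1) (d - N₀ + 1)).toNat ?_
      (-p - 1).toNat (by omega)
    · rw [Int.toNat_of_nonneg (by omega)] at key
      convert key using 2 <;> ring
    · intro r hr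
      have hr' : d < r ∧ d - r < N₀ := by omega
      have e := h r (d - r) hr'.2
      rw [translate] at e
      rw [← e]
      symm
      have hinj : Set.InjOn (fun i : ℕ => -(i + 1 : ℤ)) (Finset.range (-N).toNat) := by
        intro i _ j _ hij
        simp only at hij
        omega
      rw [finsum_eq_sum_of_support_subset (s := (Finset.range (-N).toNat).image
        fun i : ℕ => -(i + 1 : ℤ)), Finset.sum_image hinj]
      · refine Finset.sum_congr rfl fun i _ => ?_
        rw [intChoose_zero_right, mul_one, intChoose_natCast]
        congr 2
        ring
      · intro p hp
        simp only [Finset.coe_image, Set.mem_image, Finset.coe_range, Set.mem_Iio]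
        by_contra hcon
        refine hp ?_
        dsimp only
        by_cases h1 : p < N
        · rw [hF _ _ (Or.inl h1), smul_zero]
        by_cases h2 : p < 0
        · exact absurd ⟨(-p - 1).toNat, by omega, by omega⟩ hcon
        by_cases h3 : d < p
        · rw [hq _ _ (by omega), smul_zero]
        · rw [intChoose_eq_zero (by omega) (by omega), zero_mul, zero_smul]
  by_cases ha : a < 0
  · exact translate_of_neg F c (Or.inl ha)
  refine finsum_eq_zero_of_forall_eq_zero fun p => ?_
  by_cases h1 : p < 0
  · rw [hneg _ _ h1, smul_zero]
  by_cases h2 : a + 0 + c - p < 0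
  · rw [hq _ _ h2, smul_zero]
  · rw [intChoose_eq_zero (by omega) (by omega), zero_mul, zero_smul]

/-! ### Integer powers of `x - y` -/

/-- Multiplication by `(x - y)^j`, expanded in nonnegative powers of `y`, of the series with
coefficients `F p q` that is regular in `y`. -/
def zpowMul (j : ℤ) (F : ℤ → ℤ → M) : ℤ → ℤ → M := fun p q =>
  ∑ i ∈ Finset.range (q.toNat + 1), ((-1 : ℤ) ^ i * Ring.choose j i) • F (p - j + i) (q - i)

theorem zpowMul_eq_sum {F : ℤ → ℤ → M} (hF : ∀ p q, q < 0 → F p q = 0) (j p q : ℤ) {n : ℕ}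
    (hn : q < n) : zpowMul j F p q
      = ∑ i ∈ Finset.range n, ((-1 : ℤ) ^ i * Ring.choose j i) • F (p - j + i) (q - i) := by
  rcases lt_or_ge q 0 with hq | hq
  · rw [zpowMul, Finset.sum_eq_zero fun i _ => by rw [hF _ _ (by omega), smul_zero],
      Finset.sum_eq_zero fun i _ => by rw [hF _ _ (by omega), smul_zero]]
  · refine Finset.sum_subset (fun i hi => ?_) fun i _ hi => ?_
    · rw [Finset.mem_range] at hi ⊢; omega
    · rw [Finset.mem_range] at hi
      rw [hF _ _ (by omega), smul_zero]

/-- Pascal's rule. Regularity in `y` allows the defining sums to be lengthened to a common range. -/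
theorem subMul_zpowMul {F : ℤ → ℤ → M} (hF : ∀ p q, q < 0 → F p q = 0) (j : ℤ) :
    subMul (zpowMul j F) = zpowMul (j + 1) F := by
  funext p q
  have hq : q < (q.toNat + 1 : ℕ) := by omega
  rw [subMul, zpowMul_eq_sum hF j (p - 1) q (n := q.toNat + 2) (by omega),
    zpowMul_eq_sum hF j p (q - 1) (n := q.toNat + 1) (by omega),
    zpowMul_eq_sum hF (j + 1) p q (n := q.toNat + 2) (by omega),
    Finset.sum_range_succ', Finset.sum_range_succ' _ (q.toNat + 1), add_sub_right_comm,
    ← Finset.sum_sub_distrib]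
  congr 1
  · refine Finset.sum_congr rfl fun i _ => ?_
    rw [Ring.choose_succ_succ]
    have e1 : p - 1 - j + ((i + 1 : ℕ) : ℤ) = p - j + i := by push_cast; ring
    have e2 : q - ((i + 1 : ℕ) : ℤ) = q - 1 - i := by push_cast; ring
    have e3 : p - (j + 1) + ((i + 1 : ℕ) : ℤ) = p - j + i := by push_cast; ring
    rw [e1, e2, e3, ← sub_smul]
    congr 1
    ring
  · simp only [Ring.choose_zero_right]
    congr 2
    ring

theorem zpowMul_zero (F : ℤ → ℤ → M) : zpowMul 0 F = F := by
  funext p q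
  rw [zpowMul, Finset.sum_range_succ']
  simp [Ring.choose_zero_succ]

theorem subMul_iterate_zpowMul {F : ℤ → ℤ → M} (hF : ∀ p q, q < 0 → F p q = 0) (k : ℕ) (j : ℤ) :
    subMul^[k] (zpowMul j F) = zpowMul (j + k) F := by
  induction k with
  | zero => simp
  | succ k ih =>
    rw [Function.iterate_succ_apply', ih, subMul_zpowMul hF]
    push_cast
    rw [add_assoc]

theorem zpowMul_natCast {F : ℤ → ℤ → M} (hF : ∀ p q, q < 0 → F p q = 0) (k : ℕ) :
    zpowMul k F = subMul^[k] F := by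
  have := subMul_iterate_zpowMul hF k 0
  rw [zpowMul_zero, zero_add] at this
  exact this.symm

end Arrays

/-! ### Modules over `ℂ[[ħ]]` -/

section Modules

variable {M : Type*} [AddCommGroup M] [Module Ch M]

theorem mem_hpow_iff {n : ℕ} {x : M} : x ∈ hpow n M ↔ ∃ y : M, hbar ^ n • y = x := by
  rw [hpow, Ideal.span_singleton_pow, Submodule.ideal_span_singleton_smul,
    Submodule.mem_smul_pointwise_iff_exists]
  simp

theorem map_mem_hpow {N : Type*} [AddCommGroup N] [Module Ch N] (f : M →ₗ[Ch] N) {n : ℕ} {x : M}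
    (hx : x ∈ hpow n M) : f x ∈ hpow n N := by
  obtain ⟨y, rfl⟩ := mem_hpow_iff.1 hx
  exact mem_hpow_iff.2 ⟨f y, (map_smul _ _ _).symm⟩

theorem red_eq_red_iff {n : ℕ} {x y : M} : red n M x = red n M y ↔ x - y ∈ hpow n M := by
  rw [← red_eq_zero_iff, map_sub, sub_eq_zero]

theorem isUnit_intCast {j : ℤ} (hj : j ≠ 0) : IsUnit (j : Ch) := by
  have h : IsUnit ((j : PowerSeries ℂ)) := by
    rw [← map_intCast (PowerSeries.C (R := ℂ))]
    exact (IsUnit.mk0 (j : ℂ) (Int.cast_ne_zero.2 hj)).map _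
  exact h

theorem eq_zero_of_zsmul_eq_zero (j : ℤ) (x : M) (hj : j ≠ 0) (h : j • x = 0) : x = 0 := by
  rw [← Int.cast_smul_eq_zsmul Ch] at h
  exact (isUnit_intCast hj).smul_eq_zero.1 h

theorem eq_zero_of_forall_red_eq_zero [TopFree M] {x : M} (h : ∀ n, red n M x = 0) : x = 0 := by
  have := (TopFree.complete (M := M)).toIsHausdorff
  exact this.haus x fun n => by rw [SModEq.zero]; exact red_eq_zero_iff.1 (h n)

theorem eq_of_forall_red_eq [TopFree M] {x y : M} (h : ∀ n, red n M x = red n M y) : x = y :=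
  sub_eq_zero.1 (eq_zero_of_forall_red_eq_zero fun n => by rw [map_sub, h, sub_self])

theorem eq_zero_of_hbar_pow_smul (h : ∀ x : M, hbar • x = 0 → x = 0) (n : ℕ) {x : M}
    (hx : hbar ^ n • x = 0) : x = 0 := by
  induction n with
  | zero => simpa using hx
  | succ n ih => rw [pow_succ', mul_smul] at hx; exact ih (h _ hx)

/-- A submodule is closed if it contains its `ħ`-adic closure. -/
def IsHClosed (N : Submodule Ch M) : Prop := hClosure N ≤ N

/-- A submodule `N` is saturated if `[N] = N`. -/
def IsHSaturated (N : Submodule Ch M) : Prop := ∀ x, hbar • x ∈ N → x ∈ N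

theorem IsHClosed.mem {N : Submodule Ch M} (h : IsHClosed N) {x : M}
    (hx : ∀ n, red n M x ∈ N.map (red n M)) : x ∈ N := by
  refine h fun n => ?_
  obtain ⟨y, hy, e⟩ := hx n
  exact ⟨y, hy, red_eq_red_iff.1 e.symm⟩

theorem IsHSaturated.mem_of_pow {N : Submodule Ch M} (h : IsHSaturated N) (n : ℕ) {x : M}
    (hx : hbar ^ n • x ∈ N) : x ∈ N := by
  induction n with
  | zero => simpa using hx
  | succ n ih => rw [pow_succ', mul_smul] at hx; exact ih (h _ hx)

/-- Both operations building `U^{(n)}` and the generated subspace stay inside any closed saturated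
submodule, so generation becomes an ordinary induction. -/
theorem hClosure_saturation_le {N P : Submodule Ch M} (hP : IsHClosed P) (hP' : IsHSaturated P)
    (h : N ≤ P) : hClosure (saturation N) ≤ P := by
  intro x hx
  refine hP fun n => ?_
  obtain ⟨y, ⟨m, -, hy⟩, hxy⟩ := hx n
  exact ⟨y, hP'.mem_of_pow m (h hy), hxy⟩

end Modules

/-! ### Vertex operators of modules -/

theorem compatibleAt_pair_iff {W : Type*} [AddCommGroup W] [Module Ch W] {n m : ℕ}
    {a b : PreField W} : CompatibleAt n m ![a, b] ↔
      ∀ w, ∃ N : ℤ, BddBelowBy N (subMul^[m] fun p q => red n W (a (b w q) p)) := by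
  refine forall_congr' fun w => exists_congr fun N => ⟨fun h p q hpq => ?_, fun h e he => ?_⟩
  · rw [← h ![p, q] (by rcases hpq with h | h; exacts [⟨0, h⟩, ⟨1, h⟩]), polyMul_diffProd]
    rfl
  · rw [vec_eq e, polyMul_diffProd]
    refine h _ _ ?_
    obtain ⟨i, hi⟩ := he
    fin_cases i
    exacts [Or.inl hi, Or.inr hi]

theorem CompatibleAt.mono {W : Type*} [AddCommGroup W] [Module Ch W] {n m m' : ℕ}
    {a b : PreField W} (h : CompatibleAt n m ![a, b]) (hm : m ≤ m') :
    CompatibleAt n m' ![a, b] := by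
  rw [compatibleAt_pair_iff] at h ⊢
  intro w
  obtain ⟨N, hN⟩ := h w
  refine ⟨N, ?_⟩
  rw [← Nat.sub_add_cancel hm, Function.iterate_add_apply]
  exact hN.subMul_iterate _

section

variable {V : Type*} [AddCommGroup V] [Module Ch V] [TopFree V]

/-- The adjoint module. -/
def NonlocalVA.self (A : NonlocalVA V) : VAModule A V where
  Y := A.Y
  field := A.field
  vac_left := A.vac_left
  compatible := A.compatible
  assoc := A.assoc

namespace VAModule

variable {W : Type*} [AddCommGroup W] [Module Ch W] [TopFree W] {A : NonlocalVA V}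
  (M : VAModule A W)

/-- The coefficients of `Y_W(v, x)Y_W(u, y)w` modulo `ħ^n`. -/
def prodCoeff (n : ℕ) (v u : V) (w : W) : ℤ → ℤ → Red n W :=
  fun p q => red n W (M.Y v (M.Y u w q) p)

/-- The coefficients of `Y_W(Y(v, x)Y(u, y)𝟙, z)w` modulo `ħ^n`. -/
def iterCoeff (n : ℕ) (v u : V) (w : W) : ℤ → ℤ → ℤ → Red n W :=
  fun a b c => red n W (M.Y (A.Y v (A.Y u A.vac b) a) w c)

theorem exists_compatibleAt (n : ℕ) (v u : V) : ∃ m, CompatibleAt n m ![M.Y v, M.Y u] :=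
  M.compatible 2 ![M.Y v, M.Y u] (fun i => by fin_cases i; exacts [⟨v, rfl⟩, ⟨u, rfl⟩]) n

theorem exists_bddBelowBy {n m : ℕ} {v u : V} (h : CompatibleAt n m ![M.Y v, M.Y u]) (w : W) :
    ∃ N : ℤ, BddBelowBy N (subMul^[m] (M.prodCoeff n v u w)) :=
  compatibleAt_pair_iff.1 h w

/-- Associativity in closed form: `Y_W(Y(v, x)u, z)w = x^{-m} F(z + x, z)` with `F(x, y) = (x - y)^m
Y_W(v, x)Y_W(u, y)w`. For `i + m < 0` both sides are zero. -/
theorem red_Y_Y {n m : ℕ} {v u : V} (h : CompatibleAt n m ![M.Y v, M.Y u]) (w : W) (i c : ℤ) :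
    red n W (M.Y (A.Y v u i) w c) = translate (subMul^[m] (M.prodCoeff n v u w)) (i + m) 0 c := by
  rw [← M.assoc v u n m h w i c, YE]
  split_ifs with hi
  · refine finsum_congr fun p => ?_
    rw [intChoose_zero_right, mul_one, intChoose, if_pos hi, polyMul_diffProd]
    congr 1
    rw [show i + (m : ℤ) + 0 + c - p = c + (i + m) - p by ring]
    rfl
  · exact (translate_of_neg _ _ (Or.inl (by omega))).symm

/-- This is `Y_W(Y(u, x)𝟙, z) = Y_W(u, z + x)`: since `Y_W(𝟙, z) = 1`, the pair `u, 𝟙` is compatible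
without any factor, and associativity is applied with exponent `0`. -/
theorem Y_vac_coeff (u : V) (w : W) (j c : ℤ) :
    M.Y (A.Y u A.vac j) w c = intChoose (c + j) j • M.Y u w (c + j) := by
  refine eq_of_forall_red_eq fun n => ?_
  have hp : ∀ w p q, q ≠ 0 → M.prodCoeff n u A.vac w p q = 0 := by
    intro w p q hq
    rw [prodCoeff, M.vac_left, Pi.single_eq_of_ne hq, map_zero, Pi.zero_apply, map_zero]
  have hc : CompatibleAt n 0 ![M.Y u, M.Y A.vac] := by
    rw [compatibleAt_pair_iff]
    intro w
    obtain ⟨N, hN⟩ := M.field u n w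
    refine ⟨min N 0, fun p q hpq => ?_⟩
    by_cases hq : q = 0
    · subst hq
      change red n W (M.Y u (M.Y A.vac w 0) p) = 0
      rw [M.vac_left, Pi.single_eq_same]
      exact red_eq_zero_iff.2 (hN p (by omega))
    · exact hp w p q hq
  rw [M.red_Y_Y hc, translate, finsum_eq_single _ (c + j)]
  · rw [intChoose_zero_right, mul_one, map_zsmul, Nat.cast_zero, add_zero,
      show j + 0 + c - (c + j) = 0 by ring]
    change _ • red n W (M.Y u (M.Y A.vac w 0) _) = _
    rw [M.vac_left, Pi.single_eq_same]
  · intro p hp'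
    rw [Function.iterate_zero, id, hp _ _ _ (by push_cast; omega), smul_zero]

theorem Y_der (u : V) (w : W) (c : ℤ) :
    M.Y (A.Y u A.vac 1) w c = (c + 1) • M.Y u w (c + 1) := by
  rw [Y_vac_coeff, intChoose_one_right]

/-- `Y_W(Y(v, x)∂u, z) = (∂_z - ∂_x) Y_W(Y(v, x)u, z)`. -/
theorem red_Y_Y_der (n : ℕ) (v u : V) (w : W) (i c : ℤ) :
    red n W (M.Y (A.Y v (A.Y u A.vac 1) i) w c)
      = (c + 1) • red n W (M.Y (A.Y v u i) w (c + 1))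
        - (i + 1) • red n W (M.Y (A.Y v u (i + 1)) w c) := by
  obtain ⟨m₁, h₁⟩ := M.exists_compatibleAt n v u
  obtain ⟨m₂, h₂⟩ := M.exists_compatibleAt n v (A.Y u A.vac 1)
  -- Associativity for `v, ∂u` is used with exponent `m + 1`: the Leibniz rule leaves a term with
  -- `(x - y)^m`, and `m` itself must still be large enough for `v, u`.
  set m := max m₁ m₂
  have h0 := h₁.mono (le_max_left m₁ m₂)
  have h1 := h₁.mono (show m₁ ≤ m + 1 by omega)
  have h2 := h₂.mono (show m₂ ≤ m + 1 by omega)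
  obtain ⟨N₀, hN₀⟩ := M.exists_bddBelowBy h0 w
  obtain ⟨N₁, hN₁⟩ := M.exists_bddBelowBy h1 w
  obtain ⟨N₂, hN₂⟩ := M.exists_bddBelowBy h2 w
  have hder : M.prodCoeff n v (A.Y u A.vac 1) w = derivRight (M.prodCoeff n v u w) := by
    funext p q
    rw [prodCoeff, M.Y_der, map_zsmul, Pi.smul_apply, map_zsmul]
    rfl
  set F := M.prodCoeff n v u w
  have hF : ∀ p q, subMul^[m + 1] (derivRight F) p q
      = derivRight (subMul^[m + 1] F) p q + ((m : ℤ) + 1) • subMul^[m] F p q := by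
    intro p q
    rw [derivRight_subMul_iterate, sub_add_cancel]
  have hlhs : translate (subMul^[m + 1] (derivRight F)) (i + (m + 1 : ℕ)) 0 c
      = translate (subMul^[m + 1] F) (i + (m + 1 : ℕ)) 1 c
        + ((m : ℤ) + 1) • translate (subMul^[m] F) (i + 1 + m) 0 c := by
    rw [hder] at hN₂
    have b0 : BddBelowBy (min (min N₀ N₁) N₂) (subMul^[m] F) :=
      fun p q h => hN₀ p q (by omega)
    have b1 : BddBelowBy (min (min N₀ N₁) N₂ - 1) (subMul^[m + 1] F) :=
      fun p q h => hN₁ p q (by omega)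
    have b2 : BddBelowBy (min (min N₀ N₁) N₂) (subMul^[m + 1] (derivRight F)) :=
      fun p q h => hN₂ p q (by omega)
    generalize min (min N₀ N₁) N₂ = N at b0 b1 b2
    have b0' : BddBelowBy (N - 1) (subMul^[m] F) := fun p q h => b0 p q (by omega)
    have b2' : BddBelowBy (N - 1) (subMul^[m + 1] (derivRight F)) :=
      fun p q h => b2 p q (by omega)
    set d := i + (m + 1 : ℕ) + 0 + c with hd
    rw [translate_eq_sum b2' hd.symm, translate_eq_sum b0' (d := d) (by push_cast at hd; omega),
      translate_eq_sum b1 (d := d + 1) (by omega), Finset.smul_sum]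
    have hsub : Finset.Icc (N - 1) (d - (N - 1)) ⊆ Finset.Icc (N - 1) (d + 1 - (N - 1)) :=
      Finset.Icc_subset_Icc_right (by omega)
    rw [Finset.sum_subset hsub fun p _ hp => by
        rw [b2' _ _ (by rw [Finset.mem_Icc] at *; omega), smul_zero],
      Finset.sum_subset hsub fun p _ hp => by
        rw [b0' _ _ (by rw [Finset.mem_Icc] at *; omega), smul_zero, smul_zero],
      ← Finset.sum_add_distrib]
    refine Finset.sum_congr rfl fun p _ => ?_
    rw [hF, derivRight, intChoose_one_right, intChoose_zero_right,
      show i + ((m + 1 : ℕ) : ℤ) = i + 1 + m by push_cast; ring,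
      show d + 1 - p = d - p + 1 by ring]
    module
  rw [M.red_Y_Y h2, hder, hlhs, ← M.red_Y_Y h0]
  have hrec := translationInvariant_translate hN₁ (i + (m + 1 : ℕ)) 0 c
  rw [zero_add, one_smul] at hrec
  rw [hrec, show i + ((m + 1 : ℕ) : ℤ) + 1 = i + 1 + (m + 1 : ℕ) by ring, ← M.red_Y_Y h1,
    ← M.red_Y_Y h1]
  push_cast
  module

theorem Y_vac_succ (A : NonlocalVA V) (u : V) {b : ℤ} (hb : 0 ≤ b) :
    A.Y (A.Y u A.vac b) A.vac 1 = (b + 1) • A.Y u A.vac (b + 1) := by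
  have := A.self.Y_vac_coeff u A.vac b 1
  rw [add_comm, intChoose_succ_right_self hb] at this
  exact this

/-- Apply `red_Y_Y_der` to the coefficient of `y^b` in `Y(u, y)𝟙`, whose image under `∂` is `b + 1`
times the next coefficient. -/
theorem translationInvariant_iterCoeff (n : ℕ) (v u : V) (w : W) :
    TranslationInvariant (M.iterCoeff n v u w) := by
  intro a b c
  have hneg : ∀ b : ℤ, b < 0 → A.Y u A.vac b = 0 := A.vac_right u
  rcases lt_trichotomy b (-1) with hb | rfl | hb
  · simp [iterCoeff, hneg b (by omega), hneg (b + 1) (by omega)]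
  -- At `b = -1` the coefficient with index `b + 1 = 0` need not vanish, but its factor `b + 1`
  -- does.
  · simp [iterCoeff, hneg (-1) (by omega)]
  · have h := M.red_Y_Y_der n v (A.Y u A.vac b) w a c
    rw [Y_vac_succ A u (by omega)] at h
    simp only [map_zsmul, LinearMap.smul_apply, Pi.smul_apply] at h
    exact h

theorem iterCoeff_of_neg (n : ℕ) (v u : V) (w : W) (a : ℤ) {b : ℤ} (hb : b < 0) :
    M.iterCoeff n v u w a b = 0 := by
  funext c
  simp [iterCoeff, A.vac_right u b hb]

/-- `(x - y)^m Y_W(Y(v, x)Y(u, y)𝟙, z)w` arises from `(x - y)^m Y_W(v, x)Y_W(u, y)w` by the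
substitution `(z + x, z + y)`. -/
theorem subMul_iterCoeff {n m : ℕ} {v u : V} (h : CompatibleAt n m ![M.Y v, M.Y u]) (w : W) :
    subMul^[m] (M.iterCoeff n v u w) = translate (subMul^[m] (M.prodCoeff n v u w)) := by
  obtain ⟨N, hN⟩ := M.exists_bddBelowBy h w
  have hneg : ∀ a b, b < 0 → M.iterCoeff n v u w a b = 0 :=
    fun a b hb => M.iterCoeff_of_neg n v u w a hb
  -- Both sides are translation invariant and regular in `y`. At `y = 0` the left side is `x^m
  -- Y_W(Y(v, x)u, z)w`, so the claim there is associativity.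
  refine TranslationInvariant.ext (fun j x => eq_zero_of_zsmul_eq_zero j x)
    ((M.translationInvariant_iterCoeff n v u w).subMul_iterate m)
    (translationInvariant_translate hN) (fun a b c hb => ?_)
    (fun a b c hb => translate_of_neg _ _ (Or.inr hb)) fun a c => ?_
  · rw [subMul_iterate_right_zero hneg m a b hb, Pi.zero_apply]
  · rw [subMul_iterate_zero_right hneg, iterCoeff, A.creation, M.red_Y_Y h, sub_add_cancel]

end VAModule

end

/-! ### Flatness over `ℂ[[ħ]]` -/

instance : IsDomain Ch := inferInstanceAs (IsDomain (PowerSeries ℂ))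

instance : IsPrincipalIdealRing Ch := inferInstanceAs (IsPrincipalIdealRing (PowerSeries ℂ))

theorem exists_eq_unit_mul_hbar_pow {c : Ch} (hc : c ≠ 0) :
    ∃ (n : ℕ) (u : Chˣ), c = u * hbar ^ n := by
  obtain ⟨n, u, h⟩ := IsDiscreteValuationRing.eq_unit_mul_pow_irreducible
    (show (show PowerSeries ℂ from c) ≠ 0 from hc) PowerSeries.X_irreducible
  exact ⟨n, u, h⟩

theorem hbar_ne_zero : hbar ≠ 0 := PowerSeries.X_ne_zero

/-- Every nonzero element of `ℂ[[ħ]]` is a unit times a power of `ħ`, so `ħ`-torsion is the only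
torsion; over a principal ideal domain torsion-free modules are flat. -/
theorem flat_of_hbar_torsionFree {M : Type*} [AddCommGroup M] [Module Ch M]
    (h : ∀ x : M, hbar • x = 0 → x = 0) : Module.Flat Ch M := by
  have : Module.IsTorsionFree Ch M := by
    rw [Module.isTorsionFree_iff_smul_eq_zero]
    intro c x hx
    by_cases hc : c = 0
    · exact Or.inl hc
    · obtain ⟨n, u, rfl⟩ := exists_eq_unit_mul_hbar_pow hc
      rw [mul_smul] at hx
      exact Or.inr (eq_zero_of_hbar_pow_smul h n (u.isUnit.smul_eq_zero.1 hx))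
  infer_instance

theorem eq_zero_of_hbar_smul_of_flat {M : Type*} [AddCommGroup M] [Module Ch M]
    [Module.Flat Ch M] {x : M} (hx : hbar • x = 0) : x = 0 :=
  (Module.isTorsionFree_iff_smul_eq_zero.1 inferInstance hbar x hx).resolve_left hbar_ne_zero

theorem PSH.coeff_succ_hbar_smul {R : Type} [CommRing R] [Algebra ℂ R] (n : ℕ) (f : PSH R) :
    PSH.coeff (n + 1) (hbar • f) = PSH.coeff n f := by
  rw [PSH.coeff_smul, Finset.sum_eq_single (1, n)]
  · simp [hbar, PowerSeries.coeff_one_X]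
  · rintro ⟨i, j⟩ hij hne
    rw [Finset.HasAntidiagonal.mem_antidiagonal] at hij
    have hi : i ≠ 1 := by rintro rfl; exact hne (by congr 1; omega)
    simp [hbar, PowerSeries.coeff_X, hi]
  · intro h
    exact absurd (Finset.HasAntidiagonal.mem_antidiagonal.2 (Nat.add_comm 1 n)) h

instance PSH.flat (R : Type) [CommRing R] [Algebra ℂ R] : Module.Flat Ch (PSH R) :=
  flat_of_hbar_torsionFree fun f hf => PSH.ext fun n => by
    rw [← PSH.coeff_succ_hbar_smul, hf, map_zero, map_zero]

theorem IsHSaturated.flat_quotient {M : Type*} [AddCommGroup M] [Module Ch M]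
    {K : Submodule Ch M} (hK : IsHSaturated K) : Module.Flat Ch (M ⧸ K) := by
  refine flat_of_hbar_torsionFree fun x hx => ?_
  obtain ⟨y, rfl⟩ := K.mkQ_surjective x
  rw [← map_smul, Submodule.mkQ_apply, Submodule.Quotient.mk_eq_zero] at hx
  rw [Submodule.mkQ_apply, Submodule.Quotient.mk_eq_zero]
  exact hK _ hx

/-! ### Tensors with second leg in a submodule -/

section RightTensor

variable {V : Type*} [AddCommGroup V] [Module Ch V]

theorem redS_tmul (S : CT V →ₗ[Ch] CTL V) (n : ℕ) (u v : V) :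
    redS S n (red n V u ⊗ₜ red n V v)
      = redCTL n (S (AdicCompletion.of hI (V ⊗[Ch] V) (u ⊗ₜ v))) :=
  rfl

theorem redCTL_eq {n : ℕ} {X : CTL V} {x : (V ⊗[Ch] V) ⊗[Ch] LauH}
    (h : evalRed n _ X = red n _ x) : redCTL n X
      = LinearMap.rTensor LauH (TensorProduct.map (red n V) (red n V)) x := by
  rw [redCTL, LinearMap.comp_apply, h]
  rfl

theorem redCTL_of (n : ℕ) (x : (V ⊗[Ch] V) ⊗[Ch] LauH) :
    redCTL n (AdicCompletion.of hI _ x)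
      = LinearMap.rTensor LauH (TensorProduct.map (red n V) (red n V)) x :=
  redCTL_eq rfl

theorem redCTL_eq_zero {n : ℕ} {X : CTL V} (h : X ∈ hpow n (CTL V)) : redCTL n X = 0 :=
  hpow_le_ker (redCTL n) (smul_tensor (smul_tensor smul_red)) h

theorem exists_rep (n : ℕ) (X : CTL V) : ∃ x : (V ⊗[Ch] V) ⊗[Ch] LauH,
    evalRed (n + 1) _ X = red (n + 1) _ x ∧ evalRed n _ X = red n _ x := by
  obtain ⟨x, hx⟩ := red_surjective (n + 1) _ (evalRed (n + 1) _ X)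
  refine ⟨x, hx.symm, ?_⟩
  have h := AdicCompletion.transitionMap_comp_eval_apply hI ((V ⊗[Ch] V) ⊗[Ch] LauH)
    (Nat.le_succ n) X
  refine h.symm.trans ?_
  refine (congrArg (AdicCompletion.transitionMap hI ((V ⊗[Ch] V) ⊗[Ch] LauH) (Nat.le_succ n))
    hx.symm).trans ?_
  rfl

/-- The tensors in `V ⊗ V ⊗ ℂ((z))[[ħ]]` with second leg in `K`. -/
def rightTensor (K : Submodule Ch V) : Submodule Ch ((V ⊗[Ch] V) ⊗[Ch] LauH) :=
  LinearMap.range (LinearMap.rTensor LauH (LinearMap.lTensor V K.subtype))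

/-- The tensors in `V ⊗ V ⊗ ℂ((z))[[ħ]]` modulo `ħ^n` with second leg in `K`. -/
def rightTensorRed (n : ℕ) (K : Submodule Ch V) :
    Submodule Ch ((Red n V ⊗[Ch] Red n V) ⊗[Ch] LauH) :=
  Submodule.span Ch {x | ∃ a, ∃ b ∈ K, ∃ f : LauH, x = (red n V a ⊗ₜ red n V b) ⊗ₜ f}

theorem tmul_mem_rightTensor {K : Submodule Ch V} (a : V) {b : V} (hb : b ∈ K) (f : LauH) :
    (a ⊗ₜ b) ⊗ₜ f ∈ rightTensor K :=
  ⟨(a ⊗ₜ ⟨b, hb⟩) ⊗ₜ f, rfl⟩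

theorem ker_le_rightTensor (K : Submodule Ch V) {x : (V ⊗[Ch] V) ⊗[Ch] LauH}
    (hx : LinearMap.rTensor LauH (LinearMap.lTensor V K.mkQ) x = 0) : x ∈ rightTensor K := by
  have h := rTensor_exact LauH (lTensor_exact V (LinearMap.exact_subtype_mkQ K)
    K.mkQ_surjective) (LinearMap.lTensor_surjective V K.mkQ_surjective)
  exact (h x).1 hx

theorem rightTensor_le_ker (K : Submodule Ch V) {x : (V ⊗[Ch] V) ⊗[Ch] LauH}
    (hx : x ∈ rightTensor K) : LinearMap.rTensor LauH (LinearMap.lTensor V K.mkQ) x = 0 := by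
  have h := rTensor_exact LauH (lTensor_exact V (LinearMap.exact_subtype_mkQ K)
    K.mkQ_surjective) (LinearMap.lTensor_surjective V K.mkQ_surjective)
  exact (h x).2 hx

theorem map_rightTensor (n : ℕ) (K : Submodule Ch V) {x : (V ⊗[Ch] V) ⊗[Ch] LauH}
    (hx : x ∈ rightTensor K) :
    LinearMap.rTensor LauH (TensorProduct.map (red n V) (red n V)) x ∈ rightTensorRed n K := by
  obtain ⟨x, rfl⟩ := hx
  induction x with
  | zero => simp
  | add x y hx hy => rw [map_add, map_add]; exact add_mem hx hy
  | tmul t f =>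
    induction t with
    | zero => simp
    | add x y hx hy => rw [TensorProduct.add_tmul, map_add, map_add]; exact add_mem hx hy
    | tmul a b => exact Submodule.subset_span ⟨a, b, b.2, f, rfl⟩

/-- The map `V/ħ^n V ⊗ V/ħ^n V ⊗ ℂ((z))[[ħ]] → (V ⊗ V ⊗ ℂ((z))[[ħ]])/ħ^n`. -/
def redTensorInv (n : ℕ) :
    (Red n V ⊗[Ch] Red n V) ⊗[Ch] LauH →ₗ[Ch] Red n ((V ⊗[Ch] V) ⊗[Ch] LauH) :=
  TensorProduct.lift (redLift n
    ((TensorProduct.mk Ch (V ⊗[Ch] V) LauH).compr₂ (red n ((V ⊗[Ch] V) ⊗[Ch] LauH)))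
    fun _ => LinearMap.ext fun _ => smul_red _)

/-- Lets a membership modulo `ħ^n` in the tensor product of reductions be read in the reduction of
the tensor product, where representatives can be compared. -/
theorem redTensorInv_rTensor (n : ℕ) (x : (V ⊗[Ch] V) ⊗[Ch] LauH) :
    redTensorInv n (LinearMap.rTensor LauH (TensorProduct.map (red n V) (red n V)) x)
      = red n _ x := by
  induction x with
  | zero => simp
  | add x y hx hy => rw [map_add, map_add, map_add, hx, hy]
  | tmul t f =>
    induction t with
    | zero => simp
    | add x y hx hy => rw [TensorProduct.add_tmul, map_add, map_add, map_add, hx, hy]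
    | tmul a b => rfl

theorem redTensorInv_mem {n : ℕ} {K : Submodule Ch V} {x : (Red n V ⊗[Ch] Red n V) ⊗[Ch] LauH}
    (hx : x ∈ rightTensorRed n K) : redTensorInv n x ∈ (rightTensor K).map (red n _) := by
  have h : rightTensorRed n K ≤ ((rightTensor K).map (red n _)).comap (redTensorInv n) := by
    refine Submodule.span_le.2 ?_
    rintro _ ⟨a, b, hb, f, rfl⟩
    exact ⟨_, tmul_mem_rightTensor a hb f, rfl⟩
  exact h hx

/-- For a representative `x` of `X`, the hypothesis gives `ħ(x - ħ^n y) ∈ V ⊗ K ⊗ ℂ((z))[[ħ]]` for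
some `y`. So `x - ħ^n y` maps to an `ħ`-torsion element of `V ⊗ V/K ⊗ ℂ((z))[[ħ]]`. All three
factors are flat, the middle one because `K` is saturated, so the image is zero and right exactness
puts `x - ħ^n y` in `V ⊗ K ⊗ ℂ((z))[[ħ]]`. -/
theorem redCTL_mem_of_smul [TopFree V] {K : Submodule Ch V} (hK : IsHSaturated K) {n : ℕ}
    {X : CTL V} (h : redCTL (n + 1) (hbar • X) ∈ rightTensorRed (n + 1) K) :
    redCTL n X ∈ rightTensorRed n K := by
  obtain ⟨x, hx, hx'⟩ := exists_rep n X
  rw [map_smul, redCTL_eq hx, ← map_smul] at h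
  have h' := redTensorInv_mem h
  rw [redTensorInv_rTensor] at h'
  obtain ⟨j, hj, hjx⟩ := h'
  obtain ⟨y, hy⟩ := mem_hpow_iff.1 (red_eq_red_iff.1 hjx.symm)
  have : Module.Flat Ch V := flat_of_hbar_torsionFree TopFree.torsionFree
  have : Module.Flat Ch (V ⧸ K) := hK.flat_quotient
  have hmem : x - hbar ^ n • y ∈ rightTensor K := by
    refine ker_le_rightTensor K (eq_zero_of_hbar_smul_of_flat ?_)
    have e := rightTensor_le_ker K hj
    rw [← sub_eq_zero.1 (show hbar • (x - hbar ^ n • y) - j = 0 by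
      rw [smul_sub, smul_smul, ← pow_succ', hy]; abel), map_smul] at e
    exact e
  rw [redCTL_eq hx', ← sub_add_cancel x (hbar ^ n • y), map_add, map_smul,
    smul_tensor (smul_tensor smul_red), add_zero]
  exact map_rightTensor n K hmem

end RightTensor

/-! ### The hexagon identity -/

section Hexagon

variable {V : Type*} [AddCommGroup V] [Module Ch V]

theorem extend_op13_mem (n : ℕ) {R : Type} [CommRing R] [Algebra ℂ R] (φ : Lau →ₗ[ℂ] R)
    {U : Set V}
    (G : Red n V ⊗[Ch] Red n V →ₗ[Ch] (Red n V ⊗[Ch] Red n V) ⊗[Ch] LauH) {u u' : V}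
    (hG : G (red n V u ⊗ₜ red n V u') ∈ Submodule.span Ch
      {x | ∃ a, ∃ b ∈ U, ∃ f : LauH, x = (red n V a ⊗ₜ red n V b) ⊗ₜ f}) (v : V) (r : PSH R) :
    extend φ (op13 G) (((red n V u ⊗ₜ red n V v) ⊗ₜ red n V u') ⊗ₜ r) ∈ Submodule.span Ch
      {x | ∃ a, ∃ b ∈ U, ∃ g : PSH R,
        x = ((red n V a ⊗ₜ red n V v) ⊗ₜ red n V b) ⊗ₜ g} := by
  -- With `v` and `r` fixed, the value of `extend φ (op13 G)` is a linear function `Ψ` of `G(u ⊗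
  -- u')`, so it suffices to check the generators of the span.
  let Ψ : (Red n V ⊗[Ch] Red n V) ⊗[Ch] LauH →ₗ[Ch]
      ((Red n V ⊗[Ch] Red n V) ⊗[Ch] Red n V) ⊗[Ch] PSH R :=
    LinearMap.lTensor _ (LinearMap.mul' Ch (PSH R) ∘ₗ LinearMap.rTensor (PSH R) (PSH.map φ))
    ∘ₗ (TensorProduct.assoc Ch _ LauH (PSH R)).toLinearMap
    ∘ₗ (TensorProduct.mk Ch _ (PSH R)).flip r
    ∘ₗ LinearMap.rTensor LauH perm13.toLinearMap
    ∘ₗ (TensorProduct.rightComm Ch _ LauH (Red n V)).toLinearMap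
    ∘ₗ (TensorProduct.mk Ch _ (Red n V)).flip (red n V v)
  change Ψ (G _) ∈ _
  refine (Submodule.span_le (p := (Submodule.span Ch _).comap Ψ)).2 ?_ hG
  rintro _ ⟨a, b, hb, f, rfl⟩
  exact Submodule.subset_span ⟨a, b, hb, PSH.map φ f * r, rfl⟩

theorem extend_op23_mem (n : ℕ) {R : Type} [CommRing R] [Algebra ℂ R] (φ : Lau →ₗ[ℂ] R)
    {K : Submodule Ch V}
    (G : Red n V ⊗[Ch] Red n V →ₗ[Ch] (Red n V ⊗[Ch] Red n V) ⊗[Ch] LauH) {v u : V}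
    (hG : G (red n V v ⊗ₜ red n V u) ∈ rightTensorRed n K) (a : V) (r : PSH R) :
    extend φ (op23 G) (((red n V a ⊗ₜ red n V v) ⊗ₜ red n V u) ⊗ₜ r) ∈ Submodule.span Ch
      {x | ∃ a b, ∃ y ∈ K, ∃ g : PSH R,
        x = ((red n V a ⊗ₜ red n V b) ⊗ₜ red n V y) ⊗ₜ g} := by
  let Ψ : (Red n V ⊗[Ch] Red n V) ⊗[Ch] LauH →ₗ[Ch]
      ((Red n V ⊗[Ch] Red n V) ⊗[Ch] Red n V) ⊗[Ch] PSH R :=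
    LinearMap.lTensor _ (LinearMap.mul' Ch (PSH R) ∘ₗ LinearMap.rTensor (PSH R) (PSH.map φ))
    ∘ₗ (TensorProduct.assoc Ch _ LauH (PSH R)).toLinearMap
    ∘ₗ (TensorProduct.mk Ch _ (PSH R)).flip r
    ∘ₗ LinearMap.rTensor LauH perm23.toLinearMap
    ∘ₗ (TensorProduct.rightComm Ch _ LauH (Red n V)).toLinearMap
    ∘ₗ (TensorProduct.mk Ch _ (Red n V)).flip (red n V a)
  change Ψ (G _) ∈ _
  refine (Submodule.span_le (p := (Submodule.span Ch _).comap Ψ)).2 ?_ hG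
  rintro _ ⟨x, y, hy, f, rfl⟩
  exact Submodule.subset_span ⟨a, x, y, hy, PSH.map φ f * r, rfl⟩

variable [TopFree V] {A : QuantumVA V}

theorem QuantumVA.IsSClosed.redS_mem {U : Set V} (hS : A.IsSClosed U) (n : ℕ) {u u' : V}
    (hu : u ∈ U) (hu' : u' ∈ U) : redS A.S n (red n V u ⊗ₜ red n V u') ∈ Submodule.span Ch
      {x | ∃ a, ∃ b ∈ U, ∃ f : LauH, x = (red n V a ⊗ₜ red n V b) ⊗ₜ f} := by
  have hmem : AdicCompletion.of hI (V ⊗[Ch] V) (u ⊗ₜ u') ∈ closedTensor U := fun n =>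
    ⟨_, Submodule.subset_span ⟨u, hu, u', hu', rfl⟩, by rw [sub_self]; exact zero_mem _⟩
  obtain ⟨y, hy, hxy⟩ := hS _ hmem n
  rw [redS_tmul, ← sub_add_cancel (A.S _) y, map_add, redCTL_eq_zero hxy, zero_add]
  have hle : Submodule.span Ch {x : CTL V | ∃ u ∈ U, ∃ v ∈ U, ∃ f : LauH,
      x = AdicCompletion.of hI _ ((u ⊗ₜ[Ch] v) ⊗ₜ[Ch] f)} ≤ (Submodule.span Ch
      {x | ∃ a, ∃ b ∈ U, ∃ f : LauH, x = (red n V a ⊗ₜ red n V b) ⊗ₜ f}).comap (redCTL n) := by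
    refine Submodule.span_le.2 ?_
    rintro _ ⟨a, -, b, hb, f, rfl⟩
    exact Submodule.subset_span ⟨a, b, hb, f, by rw [redCTL_of]; rfl⟩
  exact hle hy

theorem Y12_mem (n : ℕ) {K : Submodule Ch V} (c : ℤ)
    {T : ((Red n V ⊗[Ch] Red n V) ⊗[Ch] Red n V) ⊗[Ch] Lau2H}
    (hT : T ∈ Submodule.span Ch {x | ∃ a b, ∃ y ∈ K, ∃ g : Lau2H,
      x = ((red n V a ⊗ₜ red n V b) ⊗ₜ red n V y) ⊗ₜ g}) :
    A.Y12 n T c ∈ rightTensorRed n K := by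
  refine finsum_induction (· ∈ rightTensorRed n K) (zero_mem _) (fun _ _ => add_mem) fun k => ?_
  refine (Submodule.span_le (p := (rightTensorRed n K).comap _)).2 ?_ hT
  rintro _ ⟨a, b, y, hy, g, rfl⟩
  exact Submodule.subset_span ⟨A.Y a b k, y, hy, PSH.map (Lau2.coeff (c - k)) g, rfl⟩

/-- The hexagon identity moves the third leg first through `S^{13}`, where `S`-closedness keeps it
in `U`, and then through `S^{23}`, where `hv` sends it into `K`. Finally `Y^{12}` only touches the
first two legs. -/
theorem redS_Y_mem {U : Set V} (hS : A.IsSClosed U) {n : ℕ} {K : Submodule Ch V} {u v u' : V}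
    (hu : u ∈ U) (hu' : u' ∈ U)
    (hv : ∀ b ∈ U, redS A.S n (red n V v ⊗ₜ red n V b) ∈ rightTensorRed n K) (c : ℤ) :
    redS A.S n (red n V (A.Y u v c) ⊗ₜ red n V u') ∈ rightTensorRed n K := by
  have h := A.hexagon n ((red n V u ⊗ₜ red n V v) ⊗ₜ red n V u') c
  change redS A.S n (red n V (A.Y u v c) ⊗ₜ red n V u') = _ at h
  rw [h]
  refine Y12_mem n c ?_
  refine (Submodule.span_le (p := (Submodule.span Ch _).comap (extend atInner
    (op23 (redS A.S n))))).2 ?_ (extend_op13_mem n (taylor 1) (redS A.S n)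
      (hS.redS_mem n hu hu') v 1)
  rintro _ ⟨a, b, hb, g, rfl⟩
  exact extend_op23_mem n atInner (redS A.S n) (hv b hb) a g

end Hexagon

/-! ### Locality -/

section Arrays

variable {Q : Type*} [AddCommGroup Q]

theorem exists_uniform_bound {F : ℤ → ℤ → Q} (hF : ∀ p q, q < 0 → F p q = 0)
    (hb : ∀ q, ∃ N : ℤ, ∀ p < N, F p q = 0) (b : ℤ) :
    ∃ N : ℤ, ∀ p q, p < N → q ≤ b → F p q = 0 := by
  choose N hN using hb
  refine ⟨-∑ i ∈ Finset.range (b.toNat + 1), |N i|, fun p q hp hq => ?_⟩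
  rcases lt_or_ge q 0 with h | h
  · exact hF p q h
  · lift q to ℕ using h
    refine hN _ _ (hp.trans_le ?_)
    have h1 := Finset.single_le_sum (f := fun i : ℕ => |N i|) (fun i _ => abs_nonneg _)
      (Finset.mem_range.2 (show q < b.toNat + 1 by omega))
    have h2 := neg_abs_le (N q)
    omega

variable [Module Ch Q]

theorem subMul_iterate_sum_smul (s : Finset ℤ) (γ : ℤ → Ch) (G : ℤ → ℤ → ℤ → Q) (k : ℕ)
    (p q : ℤ) : subMul^[k] (fun p q => ∑ j ∈ s, γ j • G j p q) p q
      = ∑ j ∈ s, γ j • subMul^[k] (G j) p q := by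
  induction k generalizing p q with
  | zero => rfl
  | succ k ih =>
    simp only [Function.iterate_succ_apply', subMul, ih, smul_sub, Finset.sum_sub_distrib]

theorem subMul_iterate_smul (γ : Ch) (G : ℤ → ℤ → Q) (k : ℕ) :
    subMul^[k] (γ • G) = γ • subMul^[k] G := by
  induction k with
  | zero => rfl
  | succ k ih =>
    rw [Function.iterate_succ_apply', Function.iterate_succ_apply', ih]
    funext p q
    simp only [subMul, Pi.smul_apply, smul_sub]

/-- The terms of the product of `∑ j, γ j (x - y)^j`, expanded in nonnegative powers of `y`, and
the series with coefficients `F`. -/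
def expandTerm (γ : ℤ → Ch) (F : ℤ → ℤ → Q) (a b : ℤ) (qp : ℤ × ℤ) : Q :=
  (((-1 : ℤ) ^ qp.1.toNat * intChoose (qp.2 + qp.1) qp.1) • γ (qp.2 + qp.1))
    • F (a - qp.2) (b - qp.1)

/-- Regroup the terms by the total exponent `j = p + q` of `x - y`. The range of `j` is finite
uniformly over the quadrant `a ≤ a₀`, `b ≤ b₀`, as multiplication by `(x - y)^k` needs, since it
only reads smaller exponents. -/
theorem finsum_expandTerm {γ : ℤ → Ch} {F : ℤ → ℤ → Q} (hF : ∀ p q, q < 0 → F p q = 0)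
    (hb : ∀ q, ∃ N : ℤ, ∀ p < N, F p q = 0) {J : ℤ} (hγ : ∀ j < J, ∀ x : Q, γ j • x = 0)
    (a₀ b₀ : ℤ) : ∃ B : ℤ, ∀ a b, a ≤ a₀ → b ≤ b₀ →
      (Function.support (expandTerm γ F a b)).Finite ∧
      ∑ᶠ qp, expandTerm γ F a b qp = ∑ j ∈ Finset.Icc J B, γ j • zpowMul j F a b := by
  obtain ⟨N, hN⟩ := exists_uniform_bound hF hb b₀
  refine ⟨a₀ + b₀ - N, fun a b ha hb' => ?_⟩
  set s := Finset.range (b₀.toNat + 1) ×ˢ Finset.Icc J (a₀ + b₀ - N) with hs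
  let ι : ℕ × ℤ → ℤ × ℤ := fun x => ((x.1 : ℤ), x.2 - x.1)
  have hsupp : Function.support (expandTerm γ F a b) ⊆ (s.image ι : Finset (ℤ × ℤ)) := by
    rintro ⟨q, p⟩ hqp
    by_contra hcon
    refine hqp ?_
    rw [expandTerm]
    dsimp only
    by_cases h1 : q < 0
    · rw [intChoose_of_neg h1, mul_zero, zero_smul, zero_smul]
    by_cases h2 : b < q
    · rw [hF _ _ (by omega), smul_zero]
    by_cases h3 : p + q < J
    · rw [smul_assoc, hγ _ h3, smul_zero]
    by_cases h4 : a - p < N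
    · rw [hN _ _ h4 (by omega), smul_zero]
    refine absurd ?_ hcon
    rw [Finset.coe_image]
    refine ⟨(q.toNat, p + q), ?_, ?_⟩
    · rw [hs, Finset.mem_coe, Finset.mem_product, Finset.mem_range, Finset.mem_Icc]
      dsimp only
      omega
    · simp only [ι, Prod.mk.injEq]
      omega
  refine ⟨(Finset.finite_toSet _).subset hsupp, ?_⟩
  have hinj : Set.InjOn ι s := by
    rintro ⟨i, j⟩ _ ⟨i', j'⟩ _ h
    simp only [ι, Prod.mk.injEq] at h ⊢
    omega
  rw [finsum_eq_sum_of_support_subset _ hsupp, Finset.sum_image hinj, hs,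
    Finset.sum_product_right]
  refine Finset.sum_congr rfl fun j _ => ?_
  rw [zpowMul_eq_sum hF j a b (n := b₀.toNat + 1) (by omega), Finset.smul_sum]
  refine Finset.sum_congr rfl fun i _ => ?_
  simp only [expandTerm, ι, sub_add_cancel, Int.toNat_natCast, intChoose_natCast]
  rw [smul_assoc, smul_comm, show a - (j - i) = a - j + i by ring]

end Arrays

/-! ### Coefficients of `f(z_2 - z_1)` -/

section Coefficients

theorem Lau.exists_coeff_eq_zero (f : Lau) : ∃ J : ℤ, ∀ j < J, Lau.coeff j f = 0 := by
  refine ⟨HahnSeries.order (show LaurentSeries ℂ from f), fun j hj => ?_⟩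
  exact HahnSeries.coeff_eq_zero_of_lt_order hj

/-- The coefficient of `z^j`, an element of `ℂ[[ħ]]`. -/
def LauH.zcoeff (f : LauH) (j : ℤ) : Ch := PSH.toCh (PSH.map (Lau.coeff j) f)

/-- Modulo `ħ^n` only the first `n` coefficients of `f` matter, each a Laurent series with a pole of
finite order. -/
theorem LauH.exists_zcoeff_mem (n : ℕ) (f : LauH) :
    ∃ J : ℤ, ∀ j < J, ∃ c, LauH.zcoeff f j = hbar ^ n * c := by
  choose J hJ using fun l => Lau.exists_coeff_eq_zero (PSH.coeff l f)
  refine ⟨-∑ i ∈ Finset.range n, |J i|, fun j hj => ?_⟩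
  refine (PowerSeries.X_pow_dvd_iff (φ := (show PowerSeries ℂ from LauH.zcoeff f j))).2
    fun l hl => ?_
  have h : Lau.coeff j (PSH.coeff l f) = 0 := by
    refine hJ l j (hj.trans_le ?_)
    have h1 := Finset.single_le_sum (f := fun i : ℕ => |J i|) (fun i _ => abs_nonneg _)
      (Finset.mem_range.2 hl)
    have h2 := neg_abs_le (J l)
    omega
  exact (PSH.coeff_mk l fun l => Lau.coeff j (PSH.coeff l f)).trans h

theorem toCh_taylor (f : LauH) (q p : ℤ) :
    PSH.toCh (PSH.map (Lau.coeff p ∘ₗ Lau2.coeff q) (PSH.map (taylor (-1)) f))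
      = ((-1 : ℤ) ^ q.toNat * intChoose (p + q) q) • LauH.zcoeff f (p + q) := by
  refine PowerSeries.ext fun l => ?_
  have hl : PowerSeries.coeff l (show PowerSeries ℂ from
      PSH.toCh (PSH.map (Lau.coeff p ∘ₗ Lau2.coeff q) (PSH.map (taylor (-1)) f)))
      = Lau.coeff p (Lau2.coeff q (taylor (-1) (PSH.coeff l f))) := by
    refine (PSH.coeff_mk l fun l => (Lau.coeff p ∘ₗ Lau2.coeff q)
      (PSH.coeff l (PSH.map (taylor (-1)) f))).trans ?_
    exact congrArg (Lau.coeff p ∘ₗ Lau2.coeff q)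
      (PSH.coeff_mk l fun l => taylor (-1) (PSH.coeff l f))
  have hr : PowerSeries.coeff l (show PowerSeries ℂ from
      ((-1 : ℤ) ^ q.toNat * intChoose (p + q) q) • LauH.zcoeff f (p + q))
      = ((-1 : ℤ) ^ q.toNat * intChoose (p + q) q) • Lau.coeff (p + q) (PSH.coeff l f) := by
    refine (map_zsmul (PSH.coeff (R := ℂ) l) _ _).trans ?_
    exact congrArg _ (PSH.coeff_mk l fun l => Lau.coeff (p + q) (PSH.coeff l f))
  refine hl.trans (Eq.trans ?_ hr.symm)
  generalize PSH.coeff l f = g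
  change Lau.coeff p (if 0 ≤ q then (-1 : ℂ) ^ q.toNat • Lau.hasseDeriv q.toNat g else 0) = _
  split_ifs with hq
  · lift q to ℕ using hq
    rw [map_smul (Lau.coeff p), Int.toNat_natCast, intChoose_natCast, mul_smul]
    have hd : Lau.coeff p (Lau.hasseDeriv q g) = Ring.choose (p + q) q • Lau.coeff (p + q) g :=
      LaurentSeries.hasseDeriv_coeff (R := ℂ) q (show LaurentSeries ℂ from g) p
    rw [hd]
    simp only [zsmul_eq_mul, smul_eq_mul]
    push_cast
    ring
  · rw [map_zero, intChoose_of_neg (by omega), mul_zero, zero_smul]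

end Coefficients

/-! ### Uniform pole bounds from `S`-locality -/

section Locality

variable {V : Type*} [AddCommGroup V] [Module Ch V] [TopFree V]
  {W : Type*} [AddCommGroup W] [Module Ch W] [TopFree W]

/-- The terms of the coefficient of `z_1^b z_2^a` in
`Y(z_2)(1 ⊗ Y(z_1)) G(z_2 - z_1)(v ⊗ u) 𝟙`, as functions of `G(z)(v ⊗ u)`. -/
def NonlocalVA.oppositeTerm (A : NonlocalVA V) (n : ℕ) (b a : ℤ) (qp : ℤ × ℤ) :
    (Red n V ⊗[Ch] Red n V) ⊗[Ch] LauH →ₗ[Ch] Red n V :=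
  A.redYY n A.vac (a - qp.2) (b - qp.1) ∘ₗ coeffAt qp.1 qp.2
    ∘ₗ LinearMap.lTensor _ (PSH.map (taylor (-1)))

theorem NonlocalVA.oppositeTerm_tmul (A : NonlocalVA V) (n : ℕ) (a b : ℤ) (v u : V) (f : LauH) :
    (fun qp => A.oppositeTerm n b a qp ((red n V v ⊗ₜ red n V u) ⊗ₜ f))
      = expandTerm (LauH.zcoeff f) (A.self.prodCoeff n v u A.vac) a b := by
  funext qp
  rw [expandTerm, ← toCh_taylor]
  exact map_smul (A.redYY n A.vac (a - qp.2) (b - qp.1)) _ (red n V v ⊗ₜ[Ch] red n V u)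

namespace VAModule

variable {A : NonlocalVA V} (M : VAModule A W)

/-- The coefficient of `z^c` in `Y_W(-, z)w`, modulo `ħ^n`. -/
def redCoeff (n : ℕ) (w : W) (c : ℤ) : Red n V →ₗ[Ch] Red n W :=
  Red.lift n (red n W ∘ₗ LinearMap.proj c ∘ₗ M.Y.flip w) smul_red

/-- By `subMul_iterCoeff` at `x = 0` the series is `G(z, z + y)`, with `G` regular in its second
variable because `u` is regular on `w`. Substituting `z + y` there creates no poles, so the bound
`N` of `G` in its first variable serves for every power `b` of `y`. -/
theorem redCoeff_subMul_eq_zero {n : ℕ} {v u : V} {w : W} (hu : ∀ k < 0, M.Y u w k = 0) :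
    ∃ (N : ℤ) (m : ℕ), ∀ k, m ≤ k → ∀ b c, c < N →
      M.redCoeff n w c (subMul^[k] (A.self.prodCoeff n v u A.vac) 0 b) = 0 := by
  obtain ⟨m, hm⟩ := M.exists_compatibleAt n v u
  obtain ⟨N, hN⟩ := M.exists_bddBelowBy hm w
  refine ⟨N, m, fun k hk b c hc => ?_⟩
  have hN' : BddBelowBy N (subMul^[k] (M.prodCoeff n v u w)) := by
    rw [← Nat.sub_add_cancel hk, Function.iterate_add_apply]
    exact hN.subMul_iterate _
  have h := congrFun (congrFun (congrFun (M.subMul_iterCoeff (hm.mono hk) w) 0) b) c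
  rw [translate_zero_left_eq_zero (fun p q hp => hN' p q (Or.inl hp))
    (subMul_iterate_right_zero (fun p q hq => by rw [prodCoeff, hu q hq, map_zero,
      Pi.zero_apply, map_zero]) k) hc] at h
  rw [subMul_iterate_map, ← h]
  exact (subMul_iterate_map (Pi.evalAddMonoidHom (fun _ => Red n W) c)
    (M.iterCoeff n v u w) k 0 b).symm

/-- The series `Y(z_2)(1 ⊗ Y(z_1)) X(z_2 - z_1) 𝟙` is well defined, and after multiplication by
`(z_1 - z_2)^k` for large `k`, the coefficients of its constant term in `z_2` act on `w` with
uniformly bounded poles. -/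
def OppositeBounded (n : ℕ) (w : W) (X : (Red n V ⊗[Ch] Red n V) ⊗[Ch] LauH) : Prop :=
  (∀ b a, (Function.support fun qp => A.oppositeTerm n b a qp X).Finite) ∧
  ∃ (N : ℤ) (m : ℕ), ∀ k, m ≤ k → ∀ b c, c < N →
    M.redCoeff n w c (subMul^[k] (fun b a => ∑ᶠ qp, A.oppositeTerm n b a qp X) b 0) = 0

theorem oppositeBounded_tmul {n : ℕ} {v u : V} {w : W} (hu : ∀ k < 0, M.Y u w k = 0)
    (f : LauH) : M.OppositeBounded n w ((red n V v ⊗ₜ red n V u) ⊗ₜ f) := by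
  set F := A.self.prodCoeff n v u A.vac with hFdef
  have hF : ∀ p q, q < 0 → F p q = 0 := by
    intro p q hq
    change red n V (A.Y v (A.Y u A.vac q) p) = 0
    rw [A.vac_right u q hq, map_zero, Pi.zero_apply, map_zero]
  have hb : ∀ q, ∃ N : ℤ, ∀ p < N, F p q = 0 := by
    intro q
    obtain ⟨N, hN⟩ := A.field v n (A.Y u A.vac q)
    exact ⟨N, fun p hp => red_eq_zero_iff.2 (hN p hp)⟩
  obtain ⟨J, hJ⟩ := LauH.exists_zcoeff_mem n f
  have hγ : ∀ j < J, ∀ x : Red n V, LauH.zcoeff f j • x = 0 := by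
    intro j hj x
    obtain ⟨c, hc⟩ := hJ j hj
    rw [hc, mul_smul, smul_red]
  obtain ⟨N, m, hm⟩ := M.redCoeff_subMul_eq_zero (n := n) (v := v) hu
  simp only [OppositeBounded, A.oppositeTerm_tmul]
  -- Only exponents `j ≥ J` of `z_2 - z_1` survive modulo `ħ^n`, so `k ≥ m - J` makes every `j + k`
  -- at least `m`, and a natural number.
  refine ⟨fun b a => ?_, N, (m - J).toNat, fun k hk b c hc => ?_⟩
  · obtain ⟨B, hB⟩ := finsum_expandTerm hF hb hγ a b
    exact (hB a b le_rfl le_rfl).1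
  · obtain ⟨B, hB⟩ := finsum_expandTerm hF hb hγ 0 b
    -- Here `x = z_2` and `y = z_1`, while the opposite series lists `z_1` first; the exchange costs
    -- only a sign.
    rw [subMul_iterate_swap (fun a b => ∑ᶠ qp, expandTerm (LauH.zcoeff f) F a b qp) k b 0,
      subMul_iterate_eqOn (fun p q hp hq => (hB p q hp hq).2) k 0 b le_rfl le_rfl,
      subMul_iterate_sum_smul, map_zsmul, map_sum, Finset.sum_eq_zero, smul_zero]
    intro j hj
    rw [Finset.mem_Icc] at hj
    obtain ⟨i, hi⟩ : ∃ i : ℕ, j + k = i := ⟨(j + k).toNat, by omega⟩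
    rw [subMul_iterate_zpowMul hF, hi, zpowMul_natCast hF, map_smul,
      hm i (by omega) b c hc, smul_zero]

theorem OppositeBounded.add {n : ℕ} {w : W} {X X' : (Red n V ⊗[Ch] Red n V) ⊗[Ch] LauH}
    (h : M.OppositeBounded n w X) (h' : M.OppositeBounded n w X') :
    M.OppositeBounded n w (X + X') := by
  obtain ⟨hX, N, m, hm⟩ := h
  obtain ⟨hX', N', m', hm'⟩ := h'
  refine ⟨fun b a => ?_, min N N', max m m', fun k hk b c hc => ?_⟩
  · refine ((hX b a).union (hX' b a)).subset ?_
    simp only [map_add]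
    exact Function.support_add _ _
  · have e : (fun b a => ∑ᶠ qp, A.oppositeTerm n b a qp (X + X'))
        = (fun b a => ∑ᶠ qp, A.oppositeTerm n b a qp X)
          + fun b a => ∑ᶠ qp, A.oppositeTerm n b a qp X' := by
      funext b a
      simp only [map_add, Pi.add_apply]
      -- A `finsum` with infinite support is `0` by default and would not be additive, hence the
      -- finiteness clause in `OppositeBounded`.
      exact finsum_add_distrib (hX b a) (hX' b a)
    rw [e, subMul_iterate_add, Pi.add_apply, Pi.add_apply, map_add,
      hm k (by omega) b c (by omega), hm' k (by omega) b c (by omega), add_zero]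

theorem OppositeBounded.smul {n : ℕ} {w : W} {X : (Red n V ⊗[Ch] Red n V) ⊗[Ch] LauH}
    (γ : Ch) (h : M.OppositeBounded n w X) : M.OppositeBounded n w (γ • X) := by
  obtain ⟨hX, N, m, hm⟩ := h
  refine ⟨fun b a => ?_, N, m, fun k hk b c hc => ?_⟩
  · refine (hX b a).subset ?_
    simp only [map_smul]
    exact Function.support_const_smul_subset γ _
  · have e : (fun b a => ∑ᶠ qp, A.oppositeTerm n b a qp (γ • X))
        = γ • fun b a => ∑ᶠ qp, A.oppositeTerm n b a qp X := by
      funext b a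
      simp only [map_smul, Pi.smul_apply]
      exact (smul_finsum' γ (hX b a)).symm
    rw [e, subMul_iterate_smul, Pi.smul_apply, Pi.smul_apply, map_smul, hm k hk b c hc,
      smul_zero]

theorem OppositeBounded.zero (n : ℕ) (w : W) : M.OppositeBounded n w 0 := by
  have h := M.oppositeBounded_tmul (n := n) (v := 0) (u := 0) (w := w)
    (fun k _ => by rw [map_zero]; rfl) 0
  rwa [TensorProduct.tmul_zero] at h

theorem oppositeBounded_of_mem {n : ℕ} {w : W} {K : Submodule Ch V}
    (hK : ∀ x ∈ K, ∀ k < 0, M.Y x w k = 0) {X : (Red n V ⊗[Ch] Red n V) ⊗[Ch] LauH}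
    (hX : X ∈ rightTensorRed n K) : M.OppositeBounded n w X := by
  induction hX using Submodule.span_induction with
  | mem x hx =>
    obtain ⟨a, b, hb, f, rfl⟩ := hx
    exact M.oppositeBounded_tmul (hK b hb) f
  | zero => exact OppositeBounded.zero M n w
  | add x y _ _ hx hy => exact hx.add M hy
  | smul γ x _ hx => exact hx.smul M γ

end VAModule

theorem QuantumVA.subMul_prodCoeff (A : QuantumVA V) (n : ℕ) (u v : V) :
    ∃ m : ℕ, ∀ k, m ≤ k → subMul^[k] (A.self.prodCoeff n u v A.vac)
      = subMul^[k] fun b a => ∑ᶠ qp, A.oppositeTerm n b a qp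
          (redS A.S n (red n V v ⊗ₜ red n V u)) := by
  obtain ⟨m, hm⟩ := A.locality u v n
  refine ⟨m, fun k hk => ?_⟩
  rw [← Nat.sub_add_cancel hk, Function.iterate_add_apply, Function.iterate_add_apply]
  congr 1
  funext p q
  have h := congrFun (hm A.vac) ![p, q]
  rw [polyMul_diffProd, polyMul_diffProd] at h
  exact h

/-- In `S`-locality applied to `𝟙`, the coefficient of `z_2^0` on the left is `z_1^k Y(u, z_1)v`,
while the right side has poles on `w` bounded independently of the power of `z_1`. The gain over the
field property is that `N` does not depend on `i`. -/
theorem exists_pole_bound {A : QuantumVA V} (M : VAModule A.toNonlocalVA W) {n : ℕ} {u v : V}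
    {w : W} {K : Submodule Ch V} (hK : ∀ x ∈ K, ∀ k < 0, M.Y x w k = 0)
    (h : redS A.S n (red n V v ⊗ₜ red n V u) ∈ rightTensorRed n K) :
    ∃ N : ℤ, ∀ i c, c < N → red n W (M.Y (A.Y u v i) w c) = 0 := by
  obtain ⟨m, hm⟩ := A.subMul_prodCoeff n u v
  obtain ⟨-, N, m', hm'⟩ := M.oppositeBounded_of_mem hK h
  refine ⟨N, fun i c hc => ?_⟩
  have e := hm' (max m m') (le_max_right _ _) (i + (max m m' : ℕ)) c hc
  rw [← hm _ (le_max_left _ _), subMul_iterate_zero_right, add_sub_cancel_right,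
    VAModule.prodCoeff] at e
  · change red n W (M.Y (A.Y u (A.Y v A.vac 0) i) w c) = 0 at e
    rwa [A.creation] at e
  · intro p q hq
    change red n V (A.Y u (A.Y v A.vac q) p) = 0
    rw [A.vac_right v q hq, map_zero, Pi.zero_apply, map_zero]

/-- If `Y_W(v, z)w` is regular and `S(z)(v ⊗ u)` has its second leg in a space of vectors with this
property, then `Y_W(u_m v, z)w` is regular for all `m`. -/
theorem Y_Y_regular {A : QuantumVA V} (M : VAModule A.toNonlocalVA W) {u v : V} {w : W}
    {K : Submodule Ch V} (hK : ∀ x ∈ K, ∀ k < 0, M.Y x w k = 0) (hv : v ∈ K)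
    (h : ∀ n, redS A.S n (red n V v ⊗ₜ red n V u) ∈ rightTensorRed n K) (i : ℤ) {c : ℤ}
    (hc : c < 0) : M.Y (A.Y u v i) w c = 0 := by
  refine eq_zero_of_forall_red_eq_zero fun n => ?_
  obtain ⟨N₀, hN₀⟩ := exists_pole_bound M hK (h n)
  obtain ⟨m, hm⟩ := M.exists_compatibleAt n u v
  obtain ⟨N, hN⟩ := M.exists_bddBelowBy hm w
  rw [M.red_Y_Y hm]
  -- Regularity of `F` in `y` comes from `v ∈ K`; the bound `N₀`, uniform in the power of `x`, comes
  -- from `S`-locality.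
  refine translate_regular (N₀ := N₀) hN (subMul_iterate_right_zero (fun p q hq => ?_) m)
    (fun a c hc => ?_) hc
  · rw [VAModule.prodCoeff, hK v hv q hq, map_zero, Pi.zero_apply, map_zero]
  · have e := hN₀ (a - m) c hc
    rwa [M.red_Y_Y hm, sub_add_cancel] at e

end Locality

/-! ### Generation -/

section Generation

variable {V : Type*} [AddCommGroup V] [Module Ch V] [TopFree V]
  {W : Type*} [AddCommGroup W] [Module Ch W] [TopFree W]

/-- The vectors `v` for which `Y_W(v, z)w` is regular. -/
def VAModule.regular {A : NonlocalVA V} (M : VAModule A W) (w : W) : Submodule Ch V where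
  carrier := {v | ∀ k < 0, M.Y v w k = 0}
  zero_mem' k _ := by rw [map_zero]; rfl
  add_mem' {v v'} hv hv' k hk := by
    rw [map_add, LinearMap.add_apply, Pi.add_apply, hv k hk, hv' k hk, add_zero]
  smul_mem' γ v hv k hk := by
    rw [map_smul, LinearMap.smul_apply, Pi.smul_apply, hv k hk, smul_zero]

theorem VAModule.isHClosed_regular {A : NonlocalVA V} (M : VAModule A W) (w : W) :
    IsHClosed (M.regular w) := by
  refine fun v hv k hk => eq_zero_of_forall_red_eq_zero fun n => ?_
  obtain ⟨y, hy, hvy⟩ := hv n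
  have h := map_mem_hpow (LinearMap.proj k ∘ₗ M.Y.flip w) hvy
  rw [map_sub] at h
  change M.Y v w k - M.Y y w k ∈ hpow n W at h
  rw [hy k hk, sub_zero] at h
  exact red_eq_zero_iff.2 h

theorem VAModule.isHSaturated_regular {A : NonlocalVA V} (M : VAModule A W) (w : W) :
    IsHSaturated (M.regular w) := by
  refine fun v hv k hk => TopFree.torsionFree _ ?_
  have h := hv k hk
  rwa [map_smul, LinearMap.smul_apply, Pi.smul_apply] at h

/-- The vectors `v ∈ K` such that `S(z)(v ⊗ u)` has its second leg in `K` for all `u ∈ U`. -/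
def QuantumVA.exchangeable (A : QuantumVA V) (U : Set V) (K : Submodule Ch V) :
    Submodule Ch V where
  carrier := {v | v ∈ K ∧ ∀ u ∈ U, ∀ n,
    redS A.S n (red n V v ⊗ₜ red n V u) ∈ rightTensorRed n K}
  zero_mem' := ⟨zero_mem _, fun u _ n => by
    rw [map_zero, TensorProduct.zero_tmul, map_zero]; exact zero_mem _⟩
  add_mem' {v v'} hv hv' := ⟨add_mem hv.1 hv'.1, fun u hu n => by
    rw [map_add, TensorProduct.add_tmul, map_add]; exact add_mem (hv.2 u hu n) (hv'.2 u hu n)⟩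
  smul_mem' γ v hv := ⟨Submodule.smul_mem _ _ hv.1, fun u hu n => by
    rw [map_smul, ← TensorProduct.smul_tmul', map_smul]
    exact Submodule.smul_mem _ _ (hv.2 u hu n)⟩

theorem QuantumVA.isHClosed_exchangeable (A : QuantumVA V) (U : Set V) {K : Submodule Ch V}
    (hK : IsHClosed K) : IsHClosed (A.exchangeable U K) := by
  refine fun v hv => ⟨hK fun n => ?_, fun u hu n => ?_⟩
  · obtain ⟨y, hy, hvy⟩ := hv n
    exact ⟨y, hy.1, hvy⟩
  · obtain ⟨y, hy, hvy⟩ := hv n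
    rw [red_eq_red_iff.2 hvy]
    exact hy.2 u hu n

theorem QuantumVA.isHSaturated_exchangeable (A : QuantumVA V) (U : Set V) {K : Submodule Ch V}
    (hK : IsHSaturated K) : IsHSaturated (A.exchangeable U K) := by
  refine fun v hv => ⟨hK _ hv.1, fun u hu n => ?_⟩
  have h := hv.2 u hu (n + 1)
  rw [redS_tmul, ← TensorProduct.smul_tmul', map_smul, map_smul] at h
  rw [redS_tmul]
  exact redCTL_mem_of_smul hK h

/-- The vectors all of whose modes preserve `N`. -/
def NonlocalVA.stabilizer (A : NonlocalVA V) (N : Submodule Ch V) : Submodule Ch V where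
  carrier := {a | ∀ v ∈ N, ∀ i, A.Y a v i ∈ N}
  zero_mem' v _ i := by rw [map_zero]; exact zero_mem _
  add_mem' {a b} ha hb v hv i := by rw [map_add]; exact add_mem (ha v hv i) (hb v hv i)
  smul_mem' γ a ha v hv i := by rw [map_smul]; exact Submodule.smul_mem _ _ (ha v hv i)

variable {A : NonlocalVA V} {N : Submodule Ch V}

theorem NonlocalVA.isHClosed_stabilizer (hN : IsHClosed N) : IsHClosed (A.stabilizer N) := by
  refine fun a ha v hv i => hN fun n => ?_
  obtain ⟨b, hb, hab⟩ := ha n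
  refine ⟨_, hb v hv i, ?_⟩
  have h := map_mem_hpow (LinearMap.proj i ∘ₗ A.Y.flip v) hab
  rwa [map_sub] at h

theorem NonlocalVA.isHSaturated_stabilizer (hN : IsHSaturated N) :
    IsHSaturated (A.stabilizer N) := by
  refine fun a ha v hv i => hN _ ?_
  have h := ha v hv i
  rwa [map_smul, LinearMap.smul_apply, Pi.smul_apply] at h

/-- By associativity the coefficients of `Y(Y(a, x)b, z)v` are, modulo each `ħ^n`, integer
combinations of the `a_p b_q v`, which lie in `N`. Closedness of `N` removes the `ħ^n`. -/
theorem NonlocalVA.Y_mem_stabilizer (hN : IsHClosed N) {a b : V} (ha : a ∈ A.stabilizer N)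
    (hb : b ∈ A.stabilizer N) (i : ℤ) : A.Y a b i ∈ A.stabilizer N := by
  refine fun v hv c => hN.mem fun n => ?_
  obtain ⟨m, hm⟩ := A.self.exists_compatibleAt n a b
  have h := A.self.red_Y_Y hm v i c
  change red n V (A.Y (A.Y a b i) v c) = _ at h
  rw [h]
  have hmem : ∀ k p q, subMul^[k] (A.self.prodCoeff n a b v) p q ∈ N.map (red n V) := by
    intro k
    induction k with
    | zero => exact fun p q => ⟨_, ha _ (hb v hv q) p, rfl⟩
    | succ k ih =>
      intro p q
      rw [Function.iterate_succ_apply', subMul]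
      exact sub_mem (ih _ _) (ih _ _)
  exact finsum_induction (· ∈ N.map (red n V)) (zero_mem _) (fun _ _ => add_mem)
    fun p => zsmul_mem (hmem _ _ _) _

theorem NonlocalVA.generated_le_stabilizer (hN : IsHClosed N) (hN' : IsHSaturated N) {U : Set V}
    (hU : U ⊆ A.stabilizer N) : A.generated U ≤ A.stabilizer N := by
  have hE := isHClosed_stabilizer (A := A) hN
  have hE' := isHSaturated_stabilizer (A := A) hN'
  refine hClosure_saturation_le hE hE' (iSup_le fun n => ?_)
  induction n with
  | zero =>
    refine hClosure_saturation_le hE hE' (Submodule.span_le.2 (Set.union_subset hU ?_))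
    rintro _ rfl v hv i
    rw [A.vac_left]
    by_cases hi : i = 0
    · subst hi; rwa [Pi.single_eq_same]
    · rw [Pi.single_eq_of_ne hi]; exact zero_mem _
  | succ n ih =>
    refine hClosure_saturation_le hE hE' (Submodule.span_le.2 ?_)
    rintro _ ⟨a, ha, b, hb, m, rfl⟩
    exact Y_mem_stabilizer hN (ih ha) (ih hb) _

end Generation

end HAdic

end

theorem mainTheorem7 {V W : Type*} [AddCommGroup V] [Module HAdic.Ch V]
    [HAdic.TopFree V] [AddCommGroup W] [Module HAdic.Ch W] [HAdic.TopFree W]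
    (A : HAdic.QuantumVA V) (M : HAdic.VAModule A.toNonlocalVA W)
    (U : Set V) (hS : A.IsSClosed U) (hU : A.toNonlocalVA.IsGeneratedBy U) (wp : W)
    (hw : ∀ u ∈ U, ∀ k < 0, M.Y u wp k = 0) :
    ∀ u : V, ∀ k < 0, M.Y u wp k = 0 := by
  -- The stabilizer of `K` itself would not do: regularity of `u_m v` needs control of `S(z)(v ⊗
  -- u)`, so the induction runs on `N`, which carries this condition along.
  set K := M.regular wp
  set N := A.exchangeable U K
  have hN : HAdic.IsHClosed N := A.isHClosed_exchangeable U (M.isHClosed_regular wp)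
  have hN' : HAdic.IsHSaturated N := A.isHSaturated_exchangeable U (M.isHSaturated_regular wp)
  have hvac : A.vac ∈ N := by
    refine ⟨fun k hk => ?_, fun u hu n => ?_⟩
    · rw [M.vac_left, Pi.single_eq_of_ne hk.ne]
    · rw [HAdic.redS_tmul, A.S_vac, HAdic.redCTL_of]
      exact HAdic.map_rightTensor n K
        (HAdic.tmul_mem_rightTensor A.vac (show u ∈ K from hw u hu) 1)
  have hUN : U ⊆ A.stabilizer N := by
    refine fun u hu v hv i => ⟨fun k hk => ?_, fun u' hu' n => ?_⟩
    · exact HAdic.Y_Y_regular M (K := K) (fun _ hx => hx) hv.1 (hv.2 u hu) i hk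
    · exact HAdic.redS_Y_mem hS hu hu' (fun b hb => hv.2 b hb n) i
  intro u
  have hu : u ∈ A.stabilizer N := by
    refine HAdic.NonlocalVA.generated_le_stabilizer hN hN' hUN ?_
    rw [show A.generated U = ⊤ from hU]
    trivial
  -- The coefficient of `z^0` in `Y(u, z)𝟙` is `u` itself.
  have h := (hu A.vac hvac 0).1
  rw [A.creation] at h
  exact h
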